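/- Let $M\ge 1$, $\mathcal T>0$, $\alpha\in\mathbb R^M$, and let a net load $\ell:[0,\mathcal T]\to\mathbb R$, functions $c_1,\dots,c_M,c_g:\mathbb R\to\mathbb R$ and a constant $\kappa$ be given. Write $y_\sigma=\sum_i y_i$ for $y\in\mathbb R^M$, and $\ell'=\frac{d}{dt}\ell$. Consider the dynamics $\frac{d}{dt}x_i=-\alpha_i x_i-z_i$, $\frac{d}{dt}z_i=u_i$ $(1\le i\le M)$ with running cost $$c(x,z,u,t)=\sum_i c_i(x_i)+c_g(\ell(t)-z_\sigma)+\kappa\,[u_\sigma-\ell'(t)]^2 .$$ For $0\le t_0\le\mathcal T$ let $J^\star(x_0,z_0,t_0)$ be the infimum of $\int_{t_0}^{\mathcal T}c(x(t),z(t),u(t),t)\,dt$ over continuous $u:[t_0,\mathcal T]\to\mathbb R^M$, subject to the dynamics with $x(t_0)=x_0$, $z(t_0)=z_0$, and let $K^\star(r,s,t_0)=\inf\{J^\star(x,z,t_0):x_\sigma=r,\ z_\sigma=s\}$. An *optimal solution* for the initial condition $(x_0,z_0)$ at time $t_0<\mathcal T$ is a triple $(x^\star,z^\star,u^\star)$ on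 $(t_0,\mathcal T]$ which satisfies the dynamics there, with $(x^\star,z^\star)$ of class $C^1$ on $(t_0,\mathcal T]$, with right limits $x^\star(t_0+),z^\star(t_0+)$ satisfying $x^\star_\sigma(t_0+)=(x_0)_\sigma$, $z^\star_\sigma(t_0+)=(z_0)_\sigma$, and with finite cost over $(t_0,\mathcal T]$ equal to $J^\star(x_0,z_0,t_0)$. (The individual components may jump at $t_0$.) Assume: - (A1) $\ell$ is $C^1$; $c_1,\dots,c_M,c_g$ are non-negative and $C^2$, with second derivatives bounded below by some $\mu>0$; and $\kappa>0$. - (A2) For each $t_0\in[0,\mathcal T)$ and each initial condition there is exactly one optimal solution. - (A3) $K^\star$ is $C^1$ on $\mathbb R\times\mathbb R\times[0,\mathcal T]$. Let $(x^\star,z^\star,u^\star)$ be the optimal solution for an initial condition $(x_0,z_0)$ at time $0$, put, for $0<t\le\mathcal T$, $$\lambda^\star(t)=\partial_rK^\star(x^\star_\sigma(t),z^\star_\sigma(t),t),\qquad \beta^\star(t)=\partial_sK^\star(x^\star_\sigma(t),z^\star_\sigma(t),t),$$ and assume - (A4) $\lambda^\star$ is $C^2$ on $(0,\mathcal T]$.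 Then $(x^\star,z^\star,u^\star,\lambda^\star,\beta^\star)$ is the solution on $(0,\mathcal T]$, and the only one, of the system of $3M+2$ equations $$\tfrac{d}{dt}x_i=-\alpha_ix_i-z_i,\qquad \tfrac{d}{dt}z_i=u_i,\qquad \tfrac{d}{dt}\lambda=-c_i'(x_i)+\alpha_i\lambda\qquad(1\le i\le M),$$ $$\tfrac{d}{dt}\beta=c_g'(\ell-z_\sigma)+\lambda,\qquad u_\sigma=\ell'-\tfrac1{2\kappa}\beta,$$ (derivatives at $\mathcal T$ are one-sided) with boundary conditions $x(0+)=x^\star(0+)$, $z(0+)=z^\star(0+)$, $\lambda(\mathcal T)=0$, $\beta(\mathcal T)=0$. Consequently there is state space collapse. Each marginal cost $t\mapsto c_i'(x_i^\star(t))$ lies, as a function on $(0,\mathcal T]$, in the span of $\lambda^\star$ and $\frac{d}{dt}\lambda^\star$. The map $e(y)=(c_i'(y_i))_{1\le i\le M}$ is a $C^1$ diffeomorphism of $\mathbb R^M$, and with $V=\mathrm{span}\{(\alpha_1,\dots,\alpha_M),(1,\dots,1)\}\subset\mathbb R^M$, for all $t\in(0,\mathcal T]$, $$x^\star(t)=e^{-1}\Bigl(\bigl(\alpha_i\lambda^\star(t)-\tfrac{d}{dt}\lambda^\star(t)\bigr)_i\Bigr)\in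 e^{-1}(V),$$ where $\dim V\le 2$, and $\dim V=2$ unless all $\alpha_i$ are equal. So $x^\star$ evolves on the manifold $e^{-1}(V)$, which is two-dimensional unless all $\alpha_i$ coincide and does not depend on the initial condition or on $t$. -/

import Mathlib

open Set Filter Topology MeasureTheory

noncomputable section

namespace DemandDispatch

/-- Data of the resource allocation problem with `M` load classes: horizon `T`, leakage rates `α`,
costs `c i` on the state of charge, cost `cg` on generation, ramping coefficient `κ`
(the ramping cost is `γ ↦ κ * γ ^ 2`) and net load `ℓ` (only its values on `[0, T]` matter). -/
structure Model (M : ℕ) where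
  T : ℝ
  κ : ℝ
  α : Fin M → ℝ
  c : Fin M → ℝ → ℝ
  cg : ℝ → ℝ
  ℓ : ℝ → ℝ

namespace Model

variable {M : ℕ} (P : Model M)

/-- Time derivative of the net load on `[0, T]` (one-sided at the end points). -/
def dℓ (t : ℝ) : ℝ := derivWithin P.ℓ (Icc 0 P.T) t

/-- Running cost, after elimination of `g = ℓ - z_σ` and `γ = dℓ/dt - u_σ`. -/
def runningCost (x z u : Fin M → ℝ) (t : ℝ) : ℝ :=
  (∑ i, P.c i (x i)) + P.cg (P.ℓ t - ∑ i, z i) + P.κ * ((∑ i, u i) - P.dℓ t) ^ 2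

/-- Total cost of a trajectory over `[t₀, T]`. -/
def totalCost (t₀ : ℝ) (x z u : ℝ → Fin M → ℝ) : ℝ :=
  ∫ t in t₀..P.T, P.runningCost (x t) (z t) (u t) t

/-- The state equations `dx_i/dt = -α_i x_i - z_i`, `dz_i/dt = u_i` at every time of the
interval `s` (one-sided at end points that belong to `s`). -/
def StateEq (s : Set ℝ) (x z u : ℝ → Fin M → ℝ) : Prop :=
  ∀ t ∈ s, ∀ i,
    HasDerivWithinAt (fun τ => x τ i) (-P.α i * x t i - z t i) s t ∧
    HasDerivWithinAt (fun τ => z τ i) (u t i) s t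

/-- Trajectories with continuous input on `[t₀, T]` and initial state `(x₀, z₀)` at `t₀`. -/
structure Feasible (t₀ : ℝ) (x₀ z₀ : Fin M → ℝ) (x z u : ℝ → Fin M → ℝ) : Prop where
  continuousOn_input : ContinuousOn u (Icc t₀ P.T)
  state_eq : P.StateEq (Icc t₀ P.T) x z u
  init_x : x t₀ = x₀
  init_z : z t₀ = z₀

/-- The cost-to-go `J*(x₀, z₀, t₀)`: the infimum of the cost over continuous inputs. -/
def J (x₀ z₀ : Fin M → ℝ) (t₀ : ℝ) : ℝ :=
  sInf {v | ∃ x z u, P.Feasible t₀ x₀ z₀ x z u ∧ v = P.totalCost t₀ x z u}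

/-- `K*(r, s, t₀)`: the infimum of `J*(x, z, t₀)` over `x_σ = r`, `z_σ = s`. -/
def K (r s t₀ : ℝ) : ℝ :=
  sInf {v | ∃ x z : Fin M → ℝ, ∑ i, x i = r ∧ ∑ i, z i = s ∧ v = P.J x z t₀}

/-- `(x, z, u)` on `(t₀, T]` is an optimal solution for the initial condition `(x₀, z₀)` at `t₀`:
the state is `C¹` and solves the state equations on `(t₀, T]`, it has right-hand limits at `t₀`
whose aggregates agree with those of `(x₀, z₀)` (the individual components may jump at `t₀`), and
its cost is finite and equals the cost-to-go. -/
structure IsOptimal (t₀ : ℝ) (x₀ z₀ : Fin M → ℝ) (x z u : ℝ → Fin M → ℝ) : Prop where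
  contDiffOn_x : ContDiffOn ℝ 1 x (Ioc t₀ P.T)
  contDiffOn_z : ContDiffOn ℝ 1 z (Ioc t₀ P.T)
  state_eq : P.StateEq (Ioc t₀ P.T) x z u
  right_limits : ∃ xp zp : Fin M → ℝ,
    Tendsto x (𝓝[>] t₀) (𝓝 xp) ∧ Tendsto z (𝓝[>] t₀) (𝓝 zp) ∧
    ∑ i, xp i = ∑ i, x₀ i ∧ ∑ i, zp i = ∑ i, z₀ i
  integrable : IntervalIntegrable (fun t => P.runningCost (x t) (z t) (u t) t) volume t₀ P.T
  cost_eq : P.totalCost t₀ x z u = P.J x₀ z₀ t₀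

/-- Regularity and convexity of the data. -/
structure RegularData : Prop where
  contDiffOn_ℓ : ContDiffOn ℝ 1 P.ℓ (Icc 0 P.T)
  contDiff_c : ∀ i, ContDiff ℝ 2 (P.c i)
  contDiff_cg : ContDiff ℝ 2 P.cg
  c_nonneg : ∀ i y, 0 ≤ P.c i y
  cg_nonneg : ∀ y, 0 ≤ P.cg y
  strongly_convex : ∃ μ : ℝ, 0 < μ ∧
    (∀ i y, μ ≤ deriv (deriv (P.c i)) y) ∧ ∀ y, μ ≤ deriv (deriv P.cg) y
  κ_pos : 0 < P.κ

/-- For every initial time and initial condition there is one and only one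
optimal solution. -/
def UniqueOptimal : Prop :=
  ∀ t₀ ∈ Ico 0 P.T, ∀ x₀ z₀ : Fin M → ℝ, ∃ x z u,
    P.IsOptimal t₀ x₀ z₀ x z u ∧
    ∀ x' z' u', P.IsOptimal t₀ x₀ z₀ x' z' u' →
      EqOn x' x (Ioc t₀ P.T) ∧ EqOn z' z (Ioc t₀ P.T) ∧ EqOn u' u (Ioc t₀ P.T)

/-- The value function `K*` is `C¹` on `ℝ × ℝ × [0, T]`. -/
def ValueC1 : Prop :=
  ContDiffOn ℝ 1 (fun p : ℝ × ℝ × ℝ => P.K p.1 p.2.1 p.2.2)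
    ((univ : Set ℝ) ×ˢ (univ : Set ℝ) ×ˢ Icc 0 P.T)

/-- `λ*(t) = ∂K*/∂r (x_σ(t), z_σ(t), t)` along a state trajectory `(x, z)`. -/
def lam (x z : ℝ → Fin M → ℝ) (t : ℝ) : ℝ :=
  deriv (fun r => P.K r (∑ i, z t i) t) (∑ i, x t i)

/-- `β*(t) = ∂K*/∂s (x_σ(t), z_σ(t), t)` along a state trajectory `(x, z)`. -/
def bet (x z : ℝ → Fin M → ℝ) (t : ℝ) : ℝ :=
  deriv (fun s => P.K (∑ i, x t i) s t) (∑ i, z t i)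

/-- Along the state trajectory `(x, z)`, the co-state `λ*` is `C²` on `(0, T]`. -/
def CostateC2 (x z : ℝ → Fin M → ℝ) : Prop :=
  ContDiffOn ℝ 2 (P.lam x z) (Ioc 0 P.T)

/-- `(x, z, u, l, b)` solves the system of `3M + 2` state, co-state and input equations on
`(0, T]`, with boundary conditions `x(0+) = xp`, `z(0+) = zp`, `l(T) = 0`, `b(T) = 0`. -/
structure SolvesSystem (xp zp : Fin M → ℝ) (x z u : ℝ → Fin M → ℝ) (l b : ℝ → ℝ) : Prop where
  state_eq : P.StateEq (Ioc 0 P.T) x z u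
  costate_l : ∀ t ∈ Ioc 0 P.T, ∀ i,
    HasDerivWithinAt l (-deriv (P.c i) (x t i) + P.α i * l t) (Ioc 0 P.T) t
  costate_b : ∀ t ∈ Ioc 0 P.T,
    HasDerivWithinAt b (deriv P.cg (P.ℓ t - ∑ i, z t i) + l t) (Ioc 0 P.T) t
  input_sum : ∀ t ∈ Ioc 0 P.T, ∑ i, u t i = P.dℓ t - 1 / (2 * P.κ) * b t
  init_x : Tendsto x (𝓝[>] 0) (𝓝 xp)
  init_z : Tendsto z (𝓝[>] 0) (𝓝 zp)
  terminal_l : l P.T = 0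
  terminal_b : b P.T = 0

/-- The vector of marginal costs `(c_i'(y_i))_i`. -/
def marginalCost (y : Fin M → ℝ) : Fin M → ℝ := fun i => deriv (P.c i) (y i)

/-- The linear subspace of `ℝ^M` spanned by `(α_1, …, α_M)` and `(1, …, 1)`. -/
def collapseSubspace : Submodule ℝ (Fin M → ℝ) :=
  Submodule.span ℝ {P.α, fun _ => 1}

end Model

end DemandDispatch

end

open DemandDispatch

/-!
The costs do not see the individual `z_i`, only `z_σ`, so that the individual states of charge can
be moved in an arbitrarily short time at an arbitrarily small cost as long as `x_σ` and `z_σ` are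
prescribed: interpolating two trajectories whose aggregates agree at some time, with a weight `θ`
that rises from `0` to `1` within `1 / n` after that time, keeps the aggregate input bounded if the
terms with `θ'` in `z`, which are of order `n`, are made to cancel in `z_σ`
(`exists_feasible_interpolate`, `exists_feasible_jump`). Hence the cost-to-go depends on
the aggregates only, the reduced value function `K` satisfies the dynamic programming inequality,
and by continuity of `K` each tail of an optimal solution over `[t, T]` costs exactly
`K (x_σ t) (z_σ t) t` (`IsOptimal.totalCost_eq_K`).

A smooth perturbation of the tail, of size `ε`, starts in a state with aggregates `x_σ + ε a` and
`z_σ + ε b`, and costs at least the value of `K` there, with equality for `ε = 0`. So both sides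
have the same derivative at `ε = 0` (`envelope`), which expresses `λ` and `β` as integrals over
`[t, T]`. Perturbing the class `i` alone, by a `g` with `g' + α_i g = w`, three choices suffice:
`w = 0` gives the equation for `λ`, and then `w = 1` the one for `β`; comparing these with the
derivative in `t` of the identity for `w = τ` gives the equation for the input. The terminal
conditions hold as the integrals vanish at `t = T`.

Uniqueness follows from monotonicity of the marginal costs: for two solutions the pairing
`Δλ Δx_σ + Δβ Δz_σ` is nonincreasing and vanishes at both ends of the time interval
(`SolvesSystem.unique`). The collapse is a reading of the equations for `λ`, which say
`c_i'(x_i) = α_i λ - λ'` for every `i`, together with the fact that each `c_i'` is a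
`C¹` diffeomorphism of the line.
-/

open DemandDispatch

namespace DemandDispatch

/-! ### Calculus on closed intervals -/

lemma exists_continuous_extension {f : ℝ → ℝ} {a b : ℝ} (hab : a ≤ b)
    (hf : ContinuousOn f (Icc a b)) : ∃ F : ℝ → ℝ, Continuous F ∧ EqOn F f (Icc a b) :=
  ⟨IccExtend hab ((Icc a b).domRestrict f), hf.domRestrict.Icc_extend',
    fun t ht => by rw [IccExtend_of_mem hab _ ht, domRestrict_apply]⟩

lemma hasDerivWithinAt_glue {f g f' g' : ℝ → ℝ} {a b c : ℝ} (hab : a ≤ b) (hbc : b ≤ c)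
    (hf : ∀ t ∈ Icc a b, HasDerivWithinAt f (f' t) (Icc a b) t)
    (hg : ∀ t ∈ Icc b c, HasDerivWithinAt g (g' t) (Icc b c) t)
    (h : g b = f b) (h' : g' b = f' b) {t : ℝ} (ht : t ∈ Icc a c) :
    HasDerivWithinAt (fun τ => if τ ≤ b then f τ else g τ) (if t ≤ b then f' t else g' t)
      (Icc a c) t := by
  have hf' : ∀ t ∈ Icc a b, HasDerivWithinAt (fun τ => if τ ≤ b then f τ else g τ) (f' t)
      (Icc a b) t := fun t ht =>
    (hf t ht).congr (fun τ hτ => if_pos hτ.2) (if_pos ht.2)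
  have hg' : ∀ t ∈ Icc b c, HasDerivWithinAt (fun τ => if τ ≤ b then f τ else g τ) (g' t)
      (Icc b c) t := by
    have key : ∀ τ ∈ Icc b c, (if τ ≤ b then f τ else g τ) = g τ := by
      intro τ hτ
      split_ifs with hle
      · rw [le_antisymm hle hτ.1, h]
      · rfl
    exact fun t ht => (hg t ht).congr key (key t ht)
  rcases lt_trichotomy t b with hlt | rfl | hgt
  · rw [if_pos hlt.le]
    refine (hf' t ⟨ht.1, hlt.le⟩).mono_of_mem_nhdsWithin ?_
    filter_upwards [self_mem_nhdsWithin, mem_nhdsWithin_of_mem_nhds (Iio_mem_nhds hlt)]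
      with τ hτ hτ' using ⟨hτ.1, le_of_lt hτ'⟩
  · rw [if_pos le_rfl, ← Icc_union_Icc_eq_Icc hab hbc]
    exact (hf' t ⟨hab, le_rfl⟩).union (h' ▸ hg' t ⟨le_rfl, hbc⟩)
  · rw [if_neg hgt.not_ge]
    refine (hg' t ⟨hgt.le, ht.2⟩).mono_of_mem_nhdsWithin ?_
    filter_upwards [self_mem_nhdsWithin, mem_nhdsWithin_of_mem_nhds (Ioi_mem_nhds hgt)]
      with τ hτ hτ' using ⟨le_of_lt hτ', hτ.2⟩

lemma continuousOn_glue {E : Type*} [TopologicalSpace E] {f g : ℝ → E} {a b c : ℝ}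
    (hab : a ≤ b) (hbc : b ≤ c) (hf : ContinuousOn f (Icc a b)) (hg : ContinuousOn g (Icc b c))
    (h : g b = f b) : ContinuousOn (fun τ => if τ ≤ b then f τ else g τ) (Icc a c) := by
  rw [← Icc_union_Icc_eq_Icc hab hbc]
  refine ContinuousOn.union_of_isClosed (hf.congr fun τ hτ => if_pos hτ.2)
    (hg.congr fun τ hτ => ?_) isClosed_Icc isClosed_Icc
  show (if τ ≤ b then f τ else g τ) = g τ
  split_ifs with hle
  · rw [le_antisymm hle hτ.1, h]
  · rfl

/-- The fundamental theorem of calculus for a half-open interval on which the integrand need not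
be integrable near the excluded end point. -/
lemma hasDerivWithinAt_of_eq_tail_integral {f G : ℝ → ℝ} {T : ℝ}
    (hf : ContinuousOn f (Ioc 0 T)) (hG : ∀ t ∈ Ioc 0 T, G t = ∫ τ in t..T, f τ) {t : ℝ}
    (ht : t ∈ Ioc 0 T) : HasDerivWithinAt G (-f t) (Ioc 0 T) t := by
  have h0 : 0 < t / 2 := half_pos ht.1
  have h1 : t / 2 < t := half_lt_self ht.1
  obtain ⟨F, hF, hFf⟩ := exists_continuous_extension (h1.le.trans ht.2)
    (hf.mono (Icc_subset_Ioc_iff (h1.le.trans ht.2) |>.2 ⟨h0, le_rfl⟩))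
  have hd : HasDerivAt (fun s => -∫ τ in T..s, F τ) (-F t) t :=
    (hF.integral_hasStrictDerivAt T t).hasDerivAt.neg
  have heq : ∀ s ∈ Icc (t / 2) T, G s = -∫ τ in T..s, F τ := by
    intro s hs
    rw [hG s ⟨h0.trans_le hs.1, hs.2⟩, ← intervalIntegral.integral_symm]
    refine intervalIntegral.integral_congr fun τ hτ => ?_
    rw [uIcc_of_le hs.2] at hτ
    exact (hFf ⟨hs.1.trans hτ.1, hτ.2⟩).symm
  rw [← hFf ⟨h1.le, ht.2⟩]
  refine hd.hasDerivWithinAt.congr_of_eventuallyEq ?_ (heq t ⟨h1.le, ht.2⟩)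
  filter_upwards [self_mem_nhdsWithin, mem_nhdsWithin_of_mem_nhds (Ioi_mem_nhds h1)]
    with s hs hs' using heq s ⟨le_of_lt hs', hs.2⟩

namespace Model

variable {M : ℕ} {P : Model M}

/-! ### Running cost and value functions -/

lemma runningCost_nonneg (h : P.RegularData) (x z u : Fin M → ℝ) (t : ℝ) :
    0 ≤ P.runningCost x z u t :=
  add_nonneg (add_nonneg (Finset.sum_nonneg fun i _ => h.c_nonneg i _) (h.cg_nonneg _))
    (mul_nonneg h.κ_pos.le (sq_nonneg _))

lemma totalCost_nonneg (h : P.RegularData) {t₀ : ℝ} (ht : t₀ ≤ P.T) (x z u : ℝ → Fin M → ℝ) :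
    0 ≤ P.totalCost t₀ x z u :=
  intervalIntegral.integral_nonneg_of_forall ht fun _ => runningCost_nonneg h _ _ _ _

lemma continuousOn_dℓ (h : P.RegularData) (hT : 0 < P.T) : ContinuousOn P.dℓ (Icc 0 P.T) :=
  h.contDiffOn_ℓ.continuousOn_derivWithin (uniqueDiffOn_Icc hT) le_rfl

lemma continuous_deriv_c (h : P.RegularData) (i : Fin M) : Continuous (deriv (P.c i)) :=
  (h.contDiff_c i).continuous_deriv one_le_two

lemma continuous_deriv_cg (h : P.RegularData) : Continuous (deriv P.cg) :=
  h.contDiff_cg.continuous_deriv one_le_two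

lemma hasDerivAt_c (h : P.RegularData) (i : Fin M) (y : ℝ) :
    HasDerivAt (P.c i) (deriv (P.c i) y) y :=
  ((h.contDiff_c i).differentiable two_ne_zero y).hasDerivAt

lemma hasDerivAt_cg (h : P.RegularData) (y : ℝ) : HasDerivAt P.cg (deriv P.cg y) y :=
  (h.contDiff_cg.differentiable two_ne_zero y).hasDerivAt

lemma continuousOn_runningCost (h : P.RegularData) (hT : 0 < P.T) {s : Set ℝ}
    (hs : s ⊆ Icc 0 P.T) {x z u : ℝ → Fin M → ℝ} (hx : ContinuousOn x s)
    (hz : ContinuousOn z s) (hu : ContinuousOn u s) :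
    ContinuousOn (fun t => P.runningCost (x t) (z t) (u t) t) s := by
  have hx' := continuousOn_pi.1 hx
  have hz' := continuousOn_pi.1 hz
  have hu' := continuousOn_pi.1 hu
  refine ((continuousOn_finsetSum _ fun i _ =>
    (h.contDiff_c i).continuous.comp_continuousOn (hx' i)).add
    (h.contDiff_cg.continuous.comp_continuousOn
      ((h.contDiffOn_ℓ.continuousOn.mono hs).sub
        (continuousOn_finsetSum _ fun i _ => hz' i)))).add
    (continuousOn_const.mul (((continuousOn_finsetSum _ fun i _ => hu' i).sub
      ((continuousOn_dℓ h hT).mono hs)).pow 2))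

lemma StateEq.continuousOn_x {s : Set ℝ} {x z u : ℝ → Fin M → ℝ} (h : P.StateEq s x z u) :
    ContinuousOn x s :=
  continuousOn_pi.2 fun i t ht => (h t ht i).1.continuousWithinAt

lemma StateEq.continuousOn_z {s : Set ℝ} {x z u : ℝ → Fin M → ℝ} (h : P.StateEq s x z u) :
    ContinuousOn z s :=
  continuousOn_pi.2 fun i t ht => (h t ht i).2.continuousWithinAt

lemma StateEq.mono {s s' : Set ℝ} {x z u : ℝ → Fin M → ℝ} (h : P.StateEq s x z u)
    (hs : s' ⊆ s) : P.StateEq s' x z u :=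
  fun t ht i => ⟨(h t (hs ht) i).1.mono hs, (h t (hs ht) i).2.mono hs⟩

lemma Feasible.continuousOn_runningCost (h : P.RegularData) (hT : 0 < P.T) {t₀ : ℝ}
    (h0 : 0 ≤ t₀) {x₀ z₀ : Fin M → ℝ} {x z u : ℝ → Fin M → ℝ}
    (hf : P.Feasible t₀ x₀ z₀ x z u) :
    ContinuousOn (fun t => P.runningCost (x t) (z t) (u t) t) (Icc t₀ P.T) :=
  Model.continuousOn_runningCost h hT (Icc_subset_Icc_left h0) hf.state_eq.continuousOn_x
    hf.state_eq.continuousOn_z hf.continuousOn_input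

lemma Feasible.restrict {t₀ t₁ : ℝ} (h01 : t₀ ≤ t₁) {x₀ z₀ : Fin M → ℝ}
    {x z u : ℝ → Fin M → ℝ} (hf : P.Feasible t₀ x₀ z₀ x z u) :
    P.Feasible t₁ (x t₁) (z t₁) x z u :=
  ⟨hf.continuousOn_input.mono (Icc_subset_Icc_left h01),
    hf.state_eq.mono (Icc_subset_Icc_left h01), rfl, rfl⟩

variable (P) in
lemma exists_feasible (t₀ : ℝ) (x₀ z₀ : Fin M → ℝ) : ∃ x z u, P.Feasible t₀ x₀ z₀ x z u := by
  -- the state of charge moves at constant speed, which determines `z` and `u`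
  let v : Fin M → ℝ := fun i => -P.α i * x₀ i - z₀ i
  let x : ℝ → Fin M → ℝ := fun t i => x₀ i + (t - t₀) * v i
  have hx : ∀ i t, HasDerivAt (fun τ => x τ i) (v i) t := fun i t =>
    ((((hasDerivAt_id t).sub_const t₀).mul_const (v i)).const_add (x₀ i)).congr_deriv (one_mul _)
  refine ⟨x, fun t i => -v i - P.α i * x t i, fun t i => -P.α i * v i,
    continuousOn_const, fun t _ i => ⟨?_, ?_⟩, ?_, ?_⟩
  · exact ((hx i t).congr_deriv (by ring)).hasDerivWithinAt
  · exact ((((hx i t).const_mul (P.α i)).const_sub (-v i)).congr_deriv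
      (by ring)).hasDerivWithinAt
  · ext i; simp [x]
  · ext i; simp [x, v]

lemma J_nonneg (h : P.RegularData) {t₀ : ℝ} (ht : t₀ ≤ P.T) (x₀ z₀ : Fin M → ℝ) :
    0 ≤ P.J x₀ z₀ t₀ :=
  Real.sInf_nonneg (by rintro v ⟨x, z, u, _, rfl⟩; exact totalCost_nonneg h ht x z u)

lemma J_le (h : P.RegularData) {t₀ : ℝ} (ht : t₀ ≤ P.T) {x₀ z₀ : Fin M → ℝ}
    {x z u : ℝ → Fin M → ℝ} (hf : P.Feasible t₀ x₀ z₀ x z u) :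
    P.J x₀ z₀ t₀ ≤ P.totalCost t₀ x z u :=
  csInf_le ⟨0, by rintro v ⟨x, z, u, _, rfl⟩; exact totalCost_nonneg h ht x z u⟩
    ⟨x, z, u, hf, rfl⟩

lemma le_J {t₀ a : ℝ} {x₀ z₀ : Fin M → ℝ}
    (ha : ∀ x z u, P.Feasible t₀ x₀ z₀ x z u → a ≤ P.totalCost t₀ x z u) :
    a ≤ P.J x₀ z₀ t₀ := by
  refine le_csInf ?_ (by rintro v ⟨x, z, u, hf, rfl⟩; exact ha x z u hf)
  obtain ⟨x, z, u, hf⟩ := P.exists_feasible t₀ x₀ z₀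
  exact ⟨_, x, z, u, hf, rfl⟩

lemma K_le_J (h : P.RegularData) {t₀ : ℝ} (ht : t₀ ≤ P.T) (x₀ z₀ : Fin M → ℝ) :
    P.K (∑ i, x₀ i) (∑ i, z₀ i) t₀ ≤ P.J x₀ z₀ t₀ :=
  csInf_le ⟨0, by rintro v ⟨x, z, _, _, rfl⟩; exact J_nonneg h ht x z⟩ ⟨x₀, z₀, rfl, rfl, rfl⟩

lemma le_K (hM : 0 < M) {t₀ a r s : ℝ}
    (ha : ∀ x z : Fin M → ℝ, ∑ i, x i = r → ∑ i, z i = s → a ≤ P.J x z t₀) :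
    a ≤ P.K r s t₀ := by
  refine le_csInf ⟨_, Pi.single ⟨0, hM⟩ r, Pi.single ⟨0, hM⟩ s, by simp, by simp, rfl⟩ ?_
  rintro v ⟨x, z, hx, hz, rfl⟩
  exact ha x z hx hz

/-- A feasible trajectory may be continued after time `b` by any feasible trajectory that starts
in the state reached at `b` with the same value of the input. -/
lemma Feasible.glue {a b : ℝ} (hab : a ≤ b) (hbT : b ≤ P.T) {x₀ z₀ : Fin M → ℝ}
    {x z u x' z' u' : ℝ → Fin M → ℝ} (hf : P.Feasible a x₀ z₀ x z u)
    (hf' : P.Feasible b (x b) (z b) x' z' u') (hu : u' b = u b) :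
    P.Feasible a x₀ z₀ (fun t => if t ≤ b then x t else x' t)
      (fun t => if t ≤ b then z t else z' t) (fun t => if t ≤ b then u t else u' t) := by
  have hs := hf.state_eq.mono (Icc_subset_Icc_right hbT)
  refine ⟨continuousOn_glue hab hbT (hf.continuousOn_input.mono (Icc_subset_Icc_right hbT))
    hf'.continuousOn_input hu, fun t ht i => ⟨?_, ?_⟩, by simp [hab, hf.init_x],
    by simp [hab, hf.init_z]⟩
  · have := hasDerivWithinAt_glue hab hbT (fun t ht => (hs t ht i).1)
      (fun t ht => (hf'.state_eq t ht i).1) (congrFun hf'.init_x i)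
      (by simp only [hf'.init_x, hf'.init_z]) ht
    convert this using 1
    · ext τ; split_ifs <;> rfl
    · split_ifs <;> rfl
  · have := hasDerivWithinAt_glue hab hbT (fun t ht => (hs t ht i).2)
      (fun t ht => (hf'.state_eq t ht i).2) (congrFun hf'.init_z i) (congrFun hu i) ht
    convert this using 1
    · ext τ; split_ifs <;> rfl
    · split_ifs <;> rfl

lemma totalCost_glue (h : P.RegularData) (hT : 0 < P.T) {a b : ℝ} (ha : 0 ≤ a) (hab : a ≤ b)
    (hbT : b ≤ P.T) {x₀ z₀ : Fin M → ℝ} {x z u x' z' u' : ℝ → Fin M → ℝ}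
    (hf : P.Feasible a x₀ z₀ x z u) (hf' : P.Feasible b (x b) (z b) x' z' u') (hu : u' b = u b) :
    P.totalCost a (fun t => if t ≤ b then x t else x' t)
      (fun t => if t ≤ b then z t else z' t) (fun t => if t ≤ b then u t else u' t) =
    (∫ t in a..b, P.runningCost (x t) (z t) (u t) t) + P.totalCost b x' z' u' := by
  have hc := (hf.glue hab hbT hf' hu).continuousOn_runningCost h hT ha
  rw [totalCost, ← intervalIntegral.integral_add_adjacent_intervals (b := b)
    ((hc.mono (Icc_subset_Icc_right hbT)).intervalIntegrable_of_Icc hab)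
    ((hc.mono (Icc_subset_Icc_left hab)).intervalIntegrable_of_Icc hbT), totalCost]
  congr 1
  · refine intervalIntegral.integral_congr fun t ht => ?_
    rw [uIcc_of_le hab] at ht
    simp only [if_pos ht.2]
  · refine intervalIntegral.integral_congr_ae (ae_of_all _ fun t ht => ?_)
    rw [uIoc_of_le hbT] at ht
    simp only [if_neg ht.1.not_ge]

end Model

/-! ### Removal of jumps -/

/-- A `C²` step from `0` on `(-∞, 0]` to `1` on `[1, ∞)`, given with its first two derivatives. -/
lemma exists_smooth_step : ∃ θ θ' θ'' : ℝ → ℝ, (∀ t, HasDerivAt θ (θ' t) t) ∧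
    (∀ t, HasDerivAt θ' (θ'' t) t) ∧ Continuous θ'' ∧ (∀ t, 0 ≤ θ t ∧ θ t ≤ 1) ∧
    θ 0 = 0 ∧ θ' 0 = 0 ∧ θ'' 0 = 0 ∧ (∀ t, 1 ≤ t → θ t = 1) ∧ (∀ t, 1 ≤ t → θ' t = 0) ∧
    ∃ C, ∀ t, 0 ≤ t → |t * θ' t| ≤ C := by
  have h2 : ContDiff ℝ (1 + 1) Real.smoothTransition :=
    Real.smoothTransition.contDiff (n := 2)
  obtain ⟨d0, -, h1⟩ := contDiff_succ_iff_deriv.1 h2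
  obtain ⟨d1, c2⟩ := contDiff_one_iff_deriv.1 h1
  have z1 : ∀ t ≤ 0, deriv Real.smoothTransition t = 0 := by
    have h : EqOn (deriv Real.smoothTransition) (fun _ => 0) (Iio 0) := fun t ht => by
      have : Real.smoothTransition =ᶠ[𝓝 t] fun _ => 0 := by
        filter_upwards [Iio_mem_nhds ht] with s hs
          using Real.smoothTransition.zero_of_nonpos (le_of_lt hs)
      rw [this.deriv_eq, deriv_const]
    have := h.closure h1.continuous continuous_const
    rw [closure_Iio] at this
    exact this
  have z2 : ∀ t ≤ 0, deriv (deriv Real.smoothTransition) t = 0 := by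
    have h : EqOn (deriv (deriv Real.smoothTransition)) (fun _ => 0) (Iio 0) := fun t ht => by
      have : deriv Real.smoothTransition =ᶠ[𝓝 t] fun _ => 0 := by
        filter_upwards [Iio_mem_nhds ht] with s hs using z1 s (le_of_lt hs)
      rw [this.deriv_eq, deriv_const]
    have := h.closure c2 continuous_const
    rw [closure_Iio] at this
    exact this
  have z3 : ∀ t, 1 ≤ t → deriv Real.smoothTransition t = 0 := by
    have h : EqOn (deriv Real.smoothTransition) (fun _ => 0) (Ioi 1) := fun t ht => by
      have : Real.smoothTransition =ᶠ[𝓝 t] fun _ => 1 := by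
        filter_upwards [Ioi_mem_nhds ht] with s hs
          using Real.smoothTransition.one_of_one_le (le_of_lt hs)
      rw [this.deriv_eq, deriv_const]
    have := h.closure h1.continuous continuous_const
    rw [closure_Ioi] at this
    exact this
  obtain ⟨C, hC⟩ := (isCompact_Icc (a := (0 : ℝ)) (b := 1)).exists_bound_of_continuousOn
    (continuous_id.mul h1.continuous).continuousOn
  refine ⟨Real.smoothTransition, deriv Real.smoothTransition, deriv (deriv Real.smoothTransition),
    fun t => (d0 t).hasDerivAt, fun t => (d1 t).hasDerivAt, c2,
    fun t => ⟨Real.smoothTransition.nonneg t, Real.smoothTransition.le_one t⟩,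
    Real.smoothTransition.zero_of_nonpos le_rfl, z1 0 le_rfl, z2 0 le_rfl,
    fun t => Real.smoothTransition.one_of_one_le, z3, C, fun t ht => ?_⟩
  rcases le_total t 1 with h | h
  · exact hC t ⟨ht, h⟩
  · rw [z3 t h, mul_zero, abs_zero]
    exact (norm_nonneg _).trans (hC 0 ⟨le_rfl, zero_le_one⟩)

/-- A function that vanishes at `b` with bounded derivative grows at most linearly. -/
lemma exists_abs_le_mul_sub {f f' : ℝ → ℝ} {b T : ℝ} (hbT : b ≤ T)
    (hf : ∀ t ∈ Icc b T, HasDerivWithinAt f (f' t) (Icc b T) t)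
    (hf' : ContinuousOn f' (Icc b T)) (h0 : f b = 0) :
    ∃ L, 0 ≤ L ∧ ∀ t ∈ Icc b T, |f t| ≤ L * (t - b) := by
  obtain ⟨L, hL⟩ := isCompact_Icc.exists_bound_of_continuousOn hf'
  refine ⟨L, (norm_nonneg _).trans (hL b ⟨le_rfl, hbT⟩), fun t ht => ?_⟩
  have := (convex_Icc b T).norm_image_sub_le_of_norm_hasDerivWithin_le hf hL ⟨le_rfl, hbT⟩ ht
  rwa [h0, sub_zero, Real.norm_eq_abs, Real.norm_eq_abs, abs_of_nonneg (sub_nonneg.2 ht.1)] at this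

namespace Model

variable {M : ℕ} {P : Model M}

lemma StateEq.sum_z {s : Set ℝ} {x z u : ℝ → Fin M → ℝ} (h : P.StateEq s x z u) {t : ℝ}
    (ht : t ∈ s) : HasDerivWithinAt (fun τ => ∑ i, z τ i) (∑ i, u t i) s t :=
  HasDerivWithinAt.fun_sum fun i _ => (h t ht i).2

/-- Interpolation between two feasible trajectories with weights `1 - θ` and `θ`. The terms with
`θ'` in `z` are arranged so as to cancel in the aggregate, at the price of the correction `ρ` to
the state of charge of the class `j`. Only `θ'`, and not `θ''`, enters the aggregate input. -/
lemma exists_feasible_interpolate (j : Fin M) {b : ℝ} {x₁ z₁ y₁ w₁ : Fin M → ℝ}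
    {x z u y w v : ℝ → Fin M → ℝ} (h1 : P.Feasible b x₁ z₁ x z u)
    (h2 : P.Feasible b y₁ w₁ y w v) {θ θ' θ'' ρ : ℝ → ℝ}
    (hθ : ∀ t, HasDerivAt θ (θ' t) t) (hθ' : ∀ t, HasDerivAt θ' (θ'' t) t)
    (hθ'' : Continuous θ'') (h0 : θ b = 0) (h0' : θ' b = 0) (h0'' : θ'' b = 0)
    (hρ : ∀ t ∈ Icc b P.T, HasDerivWithinAt ρ
      (-P.α j * ρ t - θ' t * ∑ i, (y t i - x t i)) (Icc b P.T) t) (hρ0 : ρ b = 0) :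
    ∃ Z U : ℝ → Fin M → ℝ,
      P.Feasible b x₁ z₁ (fun t i => (1 - θ t) * x t i + θ t * y t i +
        (Pi.single j (ρ t) : Fin M → ℝ) i) Z U ∧
      U b = u b ∧
      (∀ t, ∑ i, Z t i = (1 - θ t) * ∑ i, z t i + θ t * ∑ i, w t i) ∧
      (∀ t, ∑ i, U t i = (1 - θ t) * ∑ i, u t i + θ t * ∑ i, v t i +
        θ' t * ∑ i, (w t i - z t i)) := by
  -- `d` is the difference of the states of charge, `d'` its derivative
  let d : ℝ → Fin M → ℝ := fun t i => y t i - x t i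
  let d' : ℝ → Fin M → ℝ := fun t i =>
    (-P.α i * y t i - w t i) - (-P.α i * x t i - z t i)
  have hd : ∀ t ∈ Icc b P.T, ∀ i, HasDerivWithinAt (fun τ => d τ i) (d' t i) (Icc b P.T) t :=
    fun t ht i => (h2.state_eq t ht i).1.sub (h1.state_eq t ht i).1
  let k : (Fin M → ℝ) → Fin M → ℝ := fun f i =>
    f i - (Pi.single j (∑ m, f m) : Fin M → ℝ) i
  have hk : ∀ f, ∑ i, k f i = 0 := fun f => by simp [k, Finset.sum_sub_distrib]
  have hkd : ∀ t ∈ Icc b P.T, ∀ i, HasDerivWithinAt (fun τ => k (d τ) i) (k (d' t) i)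
      (Icc b P.T) t := by
    intro t ht i
    refine (hd t ht i).sub ?_
    by_cases hij : i = j
    · subst hij
      simpa using HasDerivWithinAt.fun_sum fun m (_ : m ∈ Finset.univ) => hd t ht m
    · simpa [Pi.single_eq_of_ne hij] using hasDerivWithinAt_const t (Icc b P.T) (0 : ℝ)
  have hc : ∀ {f f' : ℝ → Fin M → ℝ}, (∀ t ∈ Icc b P.T, ∀ i,
      HasDerivWithinAt (fun τ => f τ i) (f' t i) (Icc b P.T) t) →
      ∀ i, ContinuousOn (fun t => f t i) (Icc b P.T) :=
    fun hf i t ht => (hf t ht i).continuousWithinAt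
  have cθ : Continuous θ := continuous_iff_continuousAt.2 fun t => (hθ t).continuousAt
  have cθ' : Continuous θ' := continuous_iff_continuousAt.2 fun t => (hθ' t).continuousAt
  have cx := continuousOn_pi.1 h1.state_eq.continuousOn_x
  have cz := continuousOn_pi.1 h1.state_eq.continuousOn_z
  have cu := continuousOn_pi.1 h1.continuousOn_input
  have cy := continuousOn_pi.1 h2.state_eq.continuousOn_x
  have cw := continuousOn_pi.1 h2.state_eq.continuousOn_z
  have cv := continuousOn_pi.1 h2.continuousOn_input
  have cd' : ∀ i, ContinuousOn (fun t => d' t i) (Icc b P.T) := fun i =>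
    ((continuousOn_const.mul (cy i)).sub (cw i)).sub ((continuousOn_const.mul (cx i)).sub (cz i))
  have ckd' : ∀ i, ContinuousOn (fun t => k (d' t) i) (Icc b P.T) := by
    intro i
    refine (cd' i).sub ?_
    by_cases hij : i = j
    · subst hij
      simpa using continuousOn_finsetSum _ fun m (_ : m ∈ Finset.univ) => cd' m
    · simpa [Pi.single_eq_of_ne hij] using continuousOn_const
  refine ⟨fun t i => (1 - θ t) * z t i + θ t * w t i - θ' t * k (d t) i,
    fun t i => (1 - θ t) * u t i + θ t * v t i + θ' t * (w t i - z t i)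
      - (θ'' t * k (d t) i + θ' t * k (d' t) i), ⟨?_, fun t ht i => ⟨?_, ?_⟩, ?_, ?_⟩, ?_, ?_, ?_⟩
  · refine continuousOn_pi.2 fun i => ?_
    have c1 : ContinuousOn (fun t => 1 - θ t) (Icc b P.T) := (continuous_const.sub cθ).continuousOn
    exact (((c1.mul (cu i)).add (cθ.continuousOn.mul (cv i))).add
      (cθ'.continuousOn.mul ((cw i).sub (cz i)))).sub
      ((hθ''.continuousOn.mul (hc hkd i)).add (cθ'.continuousOn.mul (ckd' i)))
  · have hs : HasDerivWithinAt (fun τ => (Pi.single j (ρ τ) : Fin M → ℝ) i)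
        ((Pi.single j (-P.α j * ρ t - θ' t * ∑ i, d t i) : Fin M → ℝ) i) (Icc b P.T) t := by
      by_cases hij : i = j
      · subst hij
        simpa only [Pi.single_eq_same] using hρ t ht
      · simpa [Pi.single_eq_of_ne hij] using hasDerivWithinAt_const t (Icc b P.T) (0 : ℝ)
    refine (((((hθ t).hasDerivWithinAt.const_sub 1).mul (h1.state_eq t ht i).1).add
      ((hθ t).hasDerivWithinAt.mul (h2.state_eq t ht i).1)).add hs).congr_deriv ?_
    by_cases hij : i = j
    · subst hij
      simp only [Pi.single_eq_same, k, d]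
      ring
    · simp only [Pi.single_eq_of_ne hij, k, d]
      ring
  · refine (((((hθ t).hasDerivWithinAt.const_sub 1).mul (h1.state_eq t ht i).2).add
      ((hθ t).hasDerivWithinAt.mul (h2.state_eq t ht i).2)).sub
      ((hθ' t).hasDerivWithinAt.mul (hkd t ht i))).congr_deriv ?_
    ring
  · ext i
    simp [h0, hρ0, h1.init_x]
  · ext i
    simp [h0, h0', h1.init_z]
  · ext i
    simp [h0, h0', h0'']
  · intro t
    simp only [Finset.sum_sub_distrib, Finset.sum_add_distrib, ← Finset.mul_sum, hk]
    ring
  · intro t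
    rw [Finset.sum_sub_distrib, Finset.sum_add_distrib, Finset.sum_add_distrib,
      Finset.sum_add_distrib, ← Finset.mul_sum, ← Finset.mul_sum, ← Finset.mul_sum,
      ← Finset.mul_sum, ← Finset.mul_sum, hk, hk]
    ring

/-- Dominated convergence for the total cost, which depends on `z` and `u` only through their
aggregates. -/
lemma tendsto_totalCost (h : P.RegularData) (hT : 0 < P.T) {b B : ℝ} (hb : 0 ≤ b)
    (hbT : b ≤ P.T) {X Z U : ℕ → ℝ → Fin M → ℝ} {x z u : ℝ → Fin M → ℝ}
    (hc : ∀ n, ContinuousOn (fun t => P.runningCost (X n t) (Z n t) (U n t) t) (Icc b P.T))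
    (hX : ∀ n, ∀ t ∈ Icc b P.T, ∀ i, |X n t i| ≤ B)
    (hZ : ∀ n, ∀ t ∈ Icc b P.T, |∑ i, Z n t i| ≤ B)
    (hU : ∀ n, ∀ t ∈ Icc b P.T, |∑ i, U n t i| ≤ B)
    (lX : ∀ t ∈ Ioc b P.T, ∀ i, Tendsto (fun n => X n t i) atTop (𝓝 (x t i)))
    (lZ : ∀ t ∈ Ioc b P.T, Tendsto (fun n => ∑ i, Z n t i) atTop (𝓝 (∑ i, z t i)))
    (lU : ∀ t ∈ Ioc b P.T, Tendsto (fun n => ∑ i, U n t i) atTop (𝓝 (∑ i, u t i))) :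
    Tendsto (fun n => P.totalCost b (X n) (Z n) (U n)) atTop (𝓝 (P.totalCost b x z u)) := by
  obtain ⟨L, hL⟩ := (isCompact_Icc (a := (0 : ℝ)) (b := P.T)).exists_bound_of_continuousOn
    h.contDiffOn_ℓ.continuousOn
  obtain ⟨D, hD⟩ := (isCompact_Icc (a := (0 : ℝ)) (b := P.T)).exists_bound_of_continuousOn
    (continuousOn_dℓ h hT)
  -- the running cost as a continuous function of finitely many bounded variables
  have hR : Continuous fun p : (Fin M → ℝ) × ℝ × ℝ =>
      (∑ i, P.c i (p.1 i)) + P.cg p.2.1 + P.κ * p.2.2 ^ 2 := by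
    have := fun i => (h.contDiff_c i).continuous
    have := h.contDiff_cg.continuous
    fun_prop
  obtain ⟨C, hC⟩ := ((isCompact_Icc (a := fun _ : Fin M => -B) (b := fun _ => B)).prod
    ((isCompact_Icc (a := -(L + B)) (b := L + B)).prod
      (isCompact_Icc (a := -(B + D)) (b := B + D)))).exists_bound_of_continuousOn hR.continuousOn
  refine intervalIntegral.tendsto_integral_filter_of_dominated_convergence (fun _ => C)
    (Eventually.of_forall fun n => ?_) (Eventually.of_forall fun n => ae_of_all _ fun t ht => ?_)
    intervalIntegrable_const (ae_of_all _ fun t ht => ?_)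
  · rw [uIoc_of_le hbT]
    exact ((hc n).mono Ioc_subset_Icc_self).aestronglyMeasurable measurableSet_Ioc
  · rw [uIoc_of_le hbT] at ht
    have ht' : t ∈ Icc b P.T := Ioc_subset_Icc_self ht
    have ht0 : t ∈ Icc 0 P.T := ⟨hb.trans ht'.1, ht'.2⟩
    refine hC (X n t, P.ℓ t - ∑ i, Z n t i, (∑ i, U n t i) - P.dℓ t)
      ⟨⟨fun i => (abs_le.1 (hX n t ht' i)).1, fun i => (abs_le.1 (hX n t ht' i)).2⟩,
        abs_le.1 ?_, abs_le.1 ?_⟩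
    · exact (abs_sub _ _).trans (add_le_add (hL t ht0) (hZ n t ht'))
    · exact (abs_sub _ _).trans (add_le_add (hU n t ht') (hD t ht0))
  · rw [uIoc_of_le hbT] at ht
    refine ((tendsto_finsetSum _ fun i _ => ?_).add ?_).add ?_
    · exact ((h.contDiff_c i).continuous.tendsto _).comp (lX t ht i)
    · exact (h.contDiff_cg.continuous.tendsto _).comp (tendsto_const_nhds.sub (lZ t ht))
    · exact (((lU t ht).sub tendsto_const_nhds).pow 2).const_mul _

/-- A jump between two states with the same aggregates costs nothing: a trajectory with continuous
input starts at time `b` like `(x, z, u)` and comes close to `(y, w, v)` within an arbitrarily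
short time, during which the running cost stays bounded. The equality `U b = u b` allows it to
continue a trajectory that arrives at `b` with input `u b`. -/
lemma exists_feasible_jump (hM : 0 < M) (h : P.RegularData) (hT : 0 < P.T) {b : ℝ} (hb : 0 ≤ b)
    (hbT : b ≤ P.T) {x₁ z₁ y₁ w₁ : Fin M → ℝ} {x z u y w v : ℝ → Fin M → ℝ}
    (h1 : P.Feasible b x₁ z₁ x z u) (h2 : P.Feasible b y₁ w₁ y w v)
    (hxy : ∑ i, x₁ i = ∑ i, y₁ i) (hzw : ∑ i, z₁ i = ∑ i, w₁ i) {ε : ℝ} (hε : 0 < ε) :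
    ∃ X Z U, P.Feasible b x₁ z₁ X Z U ∧ U b = u b ∧
      P.totalCost b X Z U < P.totalCost b y w v + ε := by
  obtain ⟨θ, θ', θ'', hθ, hθ', cθ'', θ01, θ0, θ'0, θ''0, θ1, θ'1, C, hC⟩ := exists_smooth_step
  have cθ : Continuous θ := continuous_iff_continuousAt.2 fun t => (hθ t).continuousAt
  have cθ' : Continuous θ' := continuous_iff_continuousAt.2 fun t => (hθ' t).continuousAt
  have hC0 : 0 ≤ C := (abs_nonneg _).trans (hC 0 le_rfl)
  have cx := continuousOn_pi.1 h1.state_eq.continuousOn_x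
  have cz := continuousOn_pi.1 h1.state_eq.continuousOn_z
  have cu := continuousOn_pi.1 h1.continuousOn_input
  have cy := continuousOn_pi.1 h2.state_eq.continuousOn_x
  have cw := continuousOn_pi.1 h2.state_eq.continuousOn_z
  have cv := continuousOn_pi.1 h2.continuousOn_input
  -- the aggregate differences vanish at `b`, hence are `O(t - b)`
  obtain ⟨L₁, hL₁, hd⟩ : ∃ L, 0 ≤ L ∧ ∀ t ∈ Icc b P.T, |∑ i, (y t i - x t i)| ≤ L * (t - b) := by
    refine exists_abs_le_mul_sub hbT (f' := fun t =>
      ∑ i, ((-P.α i * y t i - w t i) - (-P.α i * x t i - z t i))) (fun t ht => ?_) ?_ ?_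
    · exact HasDerivWithinAt.fun_sum fun i _ => (h2.state_eq t ht i).1.sub (h1.state_eq t ht i).1
    · exact continuousOn_finsetSum _ fun i _ => ((continuousOn_const.mul (cy i)).sub (cw i)).sub
        ((continuousOn_const.mul (cx i)).sub (cz i))
    · rw [h1.init_x, h2.init_x, Finset.sum_sub_distrib, hxy, sub_self]
  obtain ⟨L₂, hL₂, he⟩ : ∃ L, 0 ≤ L ∧ ∀ t ∈ Icc b P.T, |∑ i, (w t i - z t i)| ≤ L * (t - b) := by
    refine exists_abs_le_mul_sub hbT (f' := fun t => ∑ i, (v t i - u t i)) (fun t ht => ?_) ?_ ?_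
    · exact HasDerivWithinAt.fun_sum fun i _ => (h2.state_eq t ht i).2.sub (h1.state_eq t ht i).2
    · exact continuousOn_finsetSum _ fun i _ => (cv i).sub (cu i)
    · rw [h1.init_z, h2.init_z, Finset.sum_sub_distrib, hzw, sub_self]
  obtain ⟨D, cD, hD⟩ := exists_continuous_extension hbT
    (continuousOn_finsetSum Finset.univ fun i _ => (cy i).sub (cx i))
  let j : Fin M := ⟨0, hM⟩
  obtain ⟨E₁, hE₁⟩ := (isCompact_Icc (a := b) (b := P.T)).exists_bound_of_continuousOn
    (f := fun s => Real.exp (P.α j * s)) (by fun_prop)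
  obtain ⟨E₂, hE₂⟩ := (isCompact_Icc (a := b) (b := P.T)).exists_bound_of_continuousOn
    (f := fun s => Real.exp (-P.α j * s)) (by fun_prop)
  have hE₁0 : 0 ≤ E₁ := (norm_nonneg _).trans (hE₁ b ⟨le_rfl, hbT⟩)
  have hE₂0 : 0 ≤ E₂ := (norm_nonneg _).trans (hE₂ b ⟨le_rfl, hbT⟩)
  let N : ℕ → ℝ := fun n => n + 1
  have hN : ∀ n, 0 < N n := fun n => Nat.cast_add_one_pos n
  have hNlim : ∀ s, b < s → ∀ᶠ n in atTop, 1 ≤ N n * (s - b) := fun s hs =>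
    ((tendsto_atTop_add_const_right _ 1 tendsto_natCast_atTop_atTop).atTop_mul_const
      (sub_pos.2 hs)).eventually_ge_atTop 1
  -- the key bound: `θ'` grows like `n` only on an interval of length `1 / n`
  have hθ'N : ∀ n s, b ≤ s → N n * |θ' (N n * (s - b))| * (s - b) ≤ C := fun n s hs => by
    have := hC (N n * (s - b)) (mul_nonneg (hN n).le (sub_nonneg.2 hs))
    rw [abs_mul, abs_of_nonneg (mul_nonneg (hN n).le (sub_nonneg.2 hs))] at this
    linarith
  let f : ℕ → ℝ → ℝ := fun n s => Real.exp (P.α j * s) * (N n * θ' (N n * (s - b)) * D s)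
  have cf : ∀ n, Continuous (f n) := fun n => by fun_prop
  have hf : ∀ n, ∀ s ∈ Icc b P.T, |f n s| ≤ E₁ * (C * L₁) := by
    intro n s hs
    have hE : |Real.exp (P.α j * s)| ≤ E₁ := hE₁ s hs
    have h3 : |N n * θ' (N n * (s - b)) * D s| ≤ C * L₁ := by
      rw [abs_mul, abs_mul, abs_of_pos (hN n), hD hs]
      calc N n * |θ' (N n * (s - b))| * |∑ i, (y s i - x s i)|
          ≤ N n * |θ' (N n * (s - b))| * (L₁ * (s - b)) :=
            mul_le_mul_of_nonneg_left (hd s hs) (mul_nonneg (hN n).le (abs_nonneg _))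
        _ = N n * |θ' (N n * (s - b))| * (s - b) * L₁ := by ring
        _ ≤ C * L₁ := mul_le_mul_of_nonneg_right (hθ'N n s hs.1) hL₁
    rw [abs_mul]
    exact mul_le_mul hE h3 (abs_nonneg _) hE₁0
  let ρ : ℕ → ℝ → ℝ := fun n t => -(Real.exp (-P.α j * t) * ∫ s in b..t, f n s)
  have hρ : ∀ n, ∀ t ∈ Icc b P.T, HasDerivWithinAt (ρ n)
      (-P.α j * ρ n t - N n * θ' (N n * (t - b)) * ∑ i, (y t i - x t i)) (Icc b P.T) t := by
    intro n t ht
    have e1 : HasDerivAt (fun t => Real.exp (-P.α j * t)) (Real.exp (-P.α j * t) * -P.α j) t := by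
      simpa using ((hasDerivAt_id t).const_mul (-P.α j)).exp
    refine ((e1.mul ((cf n).integral_hasStrictDerivAt b t).hasDerivAt).neg.congr_deriv
      ?_).hasDerivWithinAt
    have e2 : Real.exp (-P.α j * t) * Real.exp (P.α j * t) = 1 := by
      rw [← Real.exp_add]; simp
    simp only [f, ρ, hD ht]
    linear_combination (-(N n * θ' (N n * (t - b)) * ∑ i, (y t i - x t i))) * e2
  have hρb : ∀ n, ∀ t ∈ Icc b P.T, |ρ n t| ≤ E₂ * (E₁ * (C * L₁) * (P.T - b)) := by
    intro n t ht
    have hE : |Real.exp (-P.α j * t)| ≤ E₂ := hE₂ t ht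
    have h3 : ‖∫ s in b..t, f n s‖ ≤ E₁ * (C * L₁) * |t - b| := by
      refine intervalIntegral.norm_integral_le_of_norm_le_const fun s hs => ?_
      rw [uIoc_of_le ht.1] at hs
      exact hf n s ⟨hs.1.le, hs.2.trans ht.2⟩
    have h4 : |t - b| ≤ P.T - b := by
      rw [abs_of_nonneg (sub_nonneg.2 ht.1)]
      exact sub_le_sub_right ht.2 b
    rw [abs_neg, abs_mul]
    exact mul_le_mul hE (h3.trans (mul_le_mul_of_nonneg_left h4 (by positivity)))
      (abs_nonneg _) hE₂0
  have hρlim : ∀ t ∈ Ioc b P.T, Tendsto (fun n => ρ n t) atTop (𝓝 0) := by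
    intro t ht
    have : Tendsto (fun n => ∫ s in b..t, f n s) atTop (𝓝 (∫ s in b..t, (0 : ℝ))) := by
      refine intervalIntegral.tendsto_integral_filter_of_dominated_convergence
        (fun _ => E₁ * (C * L₁)) (Eventually.of_forall fun n => (cf n).aestronglyMeasurable)
        (Eventually.of_forall fun n => ae_of_all _ fun s hs => ?_) intervalIntegrable_const
        (ae_of_all _ fun s hs => ?_)
      · rw [uIoc_of_le ht.1.le] at hs
        exact hf n s ⟨hs.1.le, hs.2.trans ht.2⟩
      · rw [uIoc_of_le ht.1.le] at hs
        refine tendsto_const_nhds.congr' ?_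
        filter_upwards [hNlim s hs.1] with n hn
        simp [f, θ'1 _ hn]
    simpa [ρ] using (this.const_mul (Real.exp (-P.α j * t))).neg
  have hlin : ∀ n t, HasDerivAt (fun t => N n * (t - b)) (N n) t := fun n t => by
    simpa using ((hasDerivAt_id t).sub_const b).const_mul (N n)
  have hθn : ∀ n t, HasDerivAt (fun t => θ (N n * (t - b))) (N n * θ' (N n * (t - b))) t :=
    fun n t => ((hθ _).comp t (hlin n t)).congr_deriv (mul_comm _ _)
  have hθ'n : ∀ n t, HasDerivAt (fun t => N n * θ' (N n * (t - b)))
      (N n * (N n * θ'' (N n * (t - b)))) t :=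
    fun n t => (((hθ' _).comp t (hlin n t)).const_mul _).congr_deriv (by ring)
  choose Z U hXZU hUb hZ hU using fun n => exists_feasible_interpolate j h1 h2 (hθn n) (hθ'n n)
    (by fun_prop) (by simp [θ0]) (by simp [θ'0]) (by simp [θ''0]) (hρ n) (by simp [ρ])
  have hlim : Tendsto (fun n => P.totalCost b (fun t i => (1 - θ (N n * (t - b))) * x t i +
      θ (N n * (t - b)) * y t i + (Pi.single j (ρ n t) : Fin M → ℝ) i) (Z n) (U n))
      atTop (𝓝 (P.totalCost b y w v)) := by
    have bd : ∀ {g : ℝ → ℝ}, ContinuousOn g (Icc b P.T) → ∃ B, 0 ≤ B ∧ ∀ t ∈ Icc b P.T, |g t| ≤ B :=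
      fun hg => by
        obtain ⟨B, hB⟩ := isCompact_Icc.exists_bound_of_continuousOn hg
        exact ⟨B, (norm_nonneg _).trans (hB b ⟨le_rfl, hbT⟩), hB⟩
    have bd' : ∀ {g : ℝ → Fin M → ℝ}, ContinuousOn g (Icc b P.T) →
        ∃ B, 0 ≤ B ∧ ∀ t ∈ Icc b P.T, ∀ i, |g t i| ≤ B := fun hg => by
      obtain ⟨B, hB⟩ := isCompact_Icc.exists_bound_of_continuousOn hg
      exact ⟨B, (norm_nonneg _).trans (hB b ⟨le_rfl, hbT⟩),
        fun t ht i => (norm_le_pi_norm _ i).trans (hB t ht)⟩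
    obtain ⟨Bx, hBx0, hBx⟩ := bd' h1.state_eq.continuousOn_x
    obtain ⟨By, hBy0, hBy⟩ := bd' h2.state_eq.continuousOn_x
    obtain ⟨Bz, hBz0, hBz⟩ := bd (continuousOn_finsetSum Finset.univ fun i _ => cz i)
    obtain ⟨Bw, hBw0, hBw⟩ := bd (continuousOn_finsetSum Finset.univ fun i _ => cw i)
    obtain ⟨Bu, hBu0, hBu⟩ := bd (continuousOn_finsetSum Finset.univ fun i _ => cu i)
    obtain ⟨Bv, hBv0, hBv⟩ := bd (continuousOn_finsetSum Finset.univ fun i _ => cv i)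
    have comb : ∀ n t p q Bp Bq : ℝ, |p| ≤ Bp → |q| ≤ Bq →
        |(1 - θ (n * (t - b))) * p + θ (n * (t - b)) * q| ≤ Bp + Bq := by
      intro n t p q Bp Bq hp hq
      obtain ⟨t0, t1⟩ := θ01 (n * (t - b))
      have a1 := mul_le_mul (show |1 - θ (n * (t - b))| ≤ 1 by
        rw [abs_le]; constructor <;> linarith) hp (abs_nonneg _) zero_le_one
      have a2 := mul_le_mul (show |θ (n * (t - b))| ≤ 1 by
        rw [abs_le]; constructor <;> linarith) hq (abs_nonneg _) zero_le_one
      refine (abs_add_le _ _).trans ?_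
      rw [abs_mul, abs_mul]
      linarith
    have R0 : 0 ≤ E₂ * (E₁ * (C * L₁) * (P.T - b)) := by
      have := sub_nonneg.2 hbT
      positivity
    have CL : 0 ≤ C * L₂ := mul_nonneg hC0 hL₂
    refine tendsto_totalCost h hT hb hbT
      (B := Bx + By + Bz + Bw + Bu + Bv + C * L₂ + E₂ * (E₁ * (C * L₁) * (P.T - b)))
      (fun n => (hXZU n).continuousOn_runningCost h hT hb) ?_ ?_ ?_ ?_ ?_ ?_
    · intro n t ht i
      have a1 := comb (N n) t _ _ _ _ (hBx t ht i) (hBy t ht i)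
      have a2 : |(Pi.single j (ρ n t) : Fin M → ℝ) i| ≤ E₂ * (E₁ * (C * L₁) * (P.T - b)) := by
        by_cases hij : i = j
        · subst hij
          rw [Pi.single_eq_same]
          exact hρb n t ht
        · rw [Pi.single_eq_of_ne hij, abs_zero]
          exact R0
      refine (abs_add_le _ _).trans ?_
      linarith
    · intro n t ht
      rw [hZ]
      have a1 := comb (N n) t _ _ _ _ (hBz t ht) (hBw t ht)
      linarith
    · intro n t ht
      rw [hU]
      have a1 := comb (N n) t _ _ _ _ (hBu t ht) (hBv t ht)
      have a2 : |N n * θ' (N n * (t - b)) * ∑ i, (w t i - z t i)| ≤ C * L₂ := by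
        rw [abs_mul, abs_mul, abs_of_pos (hN n)]
        calc N n * |θ' (N n * (t - b))| * |∑ i, (w t i - z t i)|
            ≤ N n * |θ' (N n * (t - b))| * (L₂ * (t - b)) :=
              mul_le_mul_of_nonneg_left (he t ht) (mul_nonneg (hN n).le (abs_nonneg _))
          _ = N n * |θ' (N n * (t - b))| * (t - b) * L₂ := by ring
          _ ≤ C * L₂ := mul_le_mul_of_nonneg_right (hθ'N n t ht.1) hL₂
      refine (abs_add_le _ _).trans ?_
      linarith
    · intro t ht i
      have a2 : Tendsto (fun n => (Pi.single j (ρ n t) : Fin M → ℝ) i) atTop (𝓝 0) := by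
        by_cases hij : i = j
        · subst hij
          simpa only [Pi.single_eq_same] using hρlim t ht
        · simpa only [Pi.single_eq_of_ne hij] using tendsto_const_nhds
      have a3 : Tendsto (fun n => y t i + (Pi.single j (ρ n t) : Fin M → ℝ) i) atTop
          (𝓝 (y t i)) := by simpa using a2.const_add (y t i)
      refine a3.congr' ?_
      filter_upwards [hNlim t ht.1] with n hn
      rw [θ1 _ hn]
      ring
    · intro t ht
      refine tendsto_const_nhds.congr' ?_
      filter_upwards [hNlim t ht.1] with n hn
      rw [hZ, θ1 _ hn]
      ring
    · intro t ht
      refine tendsto_const_nhds.congr' ?_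
      filter_upwards [hNlim t ht.1] with n hn
      rw [hU, θ1 _ hn, θ'1 _ hn]
      ring
  obtain ⟨n, hn⟩ := (hlim.eventually (gt_mem_nhds (lt_add_of_pos_right _ hε))).exists
  exact ⟨_, Z n, U n, hXZU n, hUb n, hn⟩

/-! ### Dynamic programming -/

/-- The cost-to-go depends on the initial state only through its aggregates. -/
lemma J_le_K (hM : 0 < M) (h : P.RegularData) (hT : 0 < P.T) {t₀ : ℝ} (h0 : 0 ≤ t₀)
    (ht : t₀ ≤ P.T) (x₀ z₀ : Fin M → ℝ) : P.J x₀ z₀ t₀ ≤ P.K (∑ i, x₀ i) (∑ i, z₀ i) t₀ := by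
  refine le_K hM fun x₁ z₁ hx hz => le_J fun y w v hf => le_of_forall_pos_lt_add fun ε hε => ?_
  obtain ⟨x, z, u, hf₀⟩ := P.exists_feasible t₀ x₀ z₀
  obtain ⟨X, Z, U, hF, -, hlt⟩ := exists_feasible_jump hM h hT h0 ht hf₀ hf hx.symm hz.symm hε
  exact (J_le h ht hF).trans_lt hlt

/-- The dynamic programming inequality for the reduced value function. -/
lemma K_le_integral_add_K (hM : 0 < M) (h : P.RegularData) (hT : 0 < P.T) {a b : ℝ}
    (ha : 0 ≤ a) (hab : a ≤ b) (hbT : b ≤ P.T) {x₀ z₀ : Fin M → ℝ} {x z u : ℝ → Fin M → ℝ}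
    (hf : P.Feasible a x₀ z₀ x z u) :
    P.K (∑ i, x₀ i) (∑ i, z₀ i) a ≤
      (∫ t in a..b, P.runningCost (x t) (z t) (u t) t) + P.K (∑ i, x b i) (∑ i, z b i) b := by
  refine (K_le_J h (hab.trans hbT) x₀ z₀).trans ?_
  rw [← sub_le_iff_le_add']
  refine le_K hM fun x₁ z₁ hx hz => le_J fun y w v hf' => le_of_forall_pos_lt_add fun ε hε => ?_
  obtain ⟨X, Z, U, hF, hU, hlt⟩ := exists_feasible_jump hM h hT (ha.trans hab) hbT
    (hf.restrict hab) hf' hx.symm hz.symm hε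
  have := J_le h (hab.trans hbT) (hf.glue hab hbT hF hU)
  rw [totalCost_glue h hT ha hab hbT hf hF hU] at this
  linarith

lemma continuousOn_Ioc_input {t₀ : ℝ} {x₀ z₀ : Fin M → ℝ} {x z u : ℝ → Fin M → ℝ}
    (ho : P.IsOptimal t₀ x₀ z₀ x z u) : ContinuousOn u (Ioc t₀ P.T) := by
  refine continuousOn_pi.2 fun i => ?_
  have hu : UniqueDiffOn ℝ (Ioc t₀ P.T) := uniqueDiffOn_Ioc _ _
  refine ((contDiffOn_pi.1 ho.contDiffOn_z i).continuousOn_derivWithin hu le_rfl).congr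
    fun t ht => ?_
  exact ((ho.state_eq t ht i).2.derivWithin (hu t ht)).symm

lemma IsOptimal.feasible {t₀ : ℝ} {x₀ z₀ : Fin M → ℝ} {x z u : ℝ → Fin M → ℝ}
    (ho : P.IsOptimal t₀ x₀ z₀ x z u) {t : ℝ} (ht : t₀ < t) :
    P.Feasible t (x t) (z t) x z u := by
  have hs : Icc t P.T ⊆ Ioc t₀ P.T := fun s hs => ⟨ht.trans_le hs.1, hs.2⟩
  exact ⟨(continuousOn_Ioc_input ho).mono hs, ho.state_eq.mono hs, rfl, rfl⟩

/-- The principle of optimality: each tail of an optimal solution attains the reduced value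
function. The inequality `≤` between times `δ` and `t` passes to the limit `δ → 0+`, since `K` is
continuous and the aggregates do not jump. -/
lemma IsOptimal.totalCost_eq_K (hM : 0 < M) (h : P.RegularData) (hT : 0 < P.T)
    (hK : P.ValueC1) {x₀ z₀ : Fin M → ℝ} {x z u : ℝ → Fin M → ℝ}
    (ho : P.IsOptimal 0 x₀ z₀ x z u) {t : ℝ} (ht : t ∈ Ioc 0 P.T) :
    P.totalCost t x z u = P.K (∑ i, x t i) (∑ i, z t i) t := by
  refine le_antisymm ?_ ((K_le_J h ht.2 _ _).trans (J_le h ht.2 (ho.feasible ht.1)))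
  have hint := ho.integrable
  have hsub : ∀ {a b : ℝ}, a ∈ Icc 0 P.T → b ∈ Icc 0 P.T →
      IntervalIntegrable (fun t => P.runningCost (x t) (z t) (u t) t) volume a b :=
    fun ha hb => hint.mono_set (by
      rw [uIcc_of_le hT.le]
      exact uIcc_subset_Icc ha hb)
  have ht' : t ∈ Icc 0 P.T := ⟨ht.1.le, ht.2⟩
  have h0' : (0 : ℝ) ∈ Icc 0 P.T := ⟨le_rfl, hT.le⟩
  have hT' : P.T ∈ Icc 0 P.T := ⟨hT.le, le_rfl⟩
  obtain ⟨xp, zp, hxp, hzp, hxs, hzs⟩ := ho.right_limits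
  have hmem : ∀ᶠ δ in 𝓝[>] (0 : ℝ), δ ∈ Ioo 0 t := Ioo_mem_nhdsGT ht.1
  have hKlim : Tendsto (fun δ => P.K (∑ i, x δ i) (∑ i, z δ i) δ) (𝓝[>] 0)
      (𝓝 (P.K (∑ i, x₀ i) (∑ i, z₀ i) 0)) := by
    have hc : Tendsto (fun p : ℝ × ℝ × ℝ => P.K p.1 p.2.1 p.2.2)
        (𝓝[(univ : Set ℝ) ×ˢ (univ : Set ℝ) ×ˢ Icc 0 P.T] (∑ i, x₀ i, ∑ i, z₀ i, 0))
        (𝓝 (P.K (∑ i, x₀ i) (∑ i, z₀ i) 0)) :=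
      ContDiffOn.continuousOn hK (∑ i, x₀ i, ∑ i, z₀ i, 0) ⟨mem_univ _, mem_univ _, h0'⟩
    have hlim : Tendsto (fun δ : ℝ => (∑ i, x δ i, ∑ i, z δ i, δ)) (𝓝[>] 0)
        (𝓝[(univ : Set ℝ) ×ˢ (univ : Set ℝ) ×ˢ Icc 0 P.T] (∑ i, x₀ i, ∑ i, z₀ i, 0)) := by
      refine tendsto_nhdsWithin_iff.2 ⟨?_, ?_⟩
      · rw [← hxs, ← hzs]
        exact (tendsto_finsetSum _ fun i _ => (tendsto_pi_nhds.1 hxp i)).prodMk_nhds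
          ((tendsto_finsetSum _ fun i _ => (tendsto_pi_nhds.1 hzp i)).prodMk_nhds
            (tendsto_id.mono_left nhdsWithin_le_nhds))
      · filter_upwards [hmem] with δ hδ
          using ⟨mem_univ _, mem_univ _, hδ.1.le, hδ.2.le.trans ht.2⟩
    have := hc.comp hlim
    simpa only [Function.comp_def] using this
  have hIlim : Tendsto (fun δ => (∫ s in δ..t, P.runningCost (x s) (z s) (u s) s) +
      P.K (∑ i, x t i) (∑ i, z t i) t) (𝓝[>] 0)
      (𝓝 ((∫ s in (0 : ℝ)..t, P.runningCost (x s) (z s) (u s) s) +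
        P.K (∑ i, x t i) (∑ i, z t i) t)) := by
    refine Tendsto.add_const _ ?_
    have hc : ContinuousWithinAt (fun δ => ∫ s in t..δ, P.runningCost (x s) (z s) (u s) s)
        (uIcc 0 P.T) 0 :=
      intervalIntegral.continuousOn_primitive_interval'
        (f := fun s => P.runningCost (x s) (z s) (u s) s) hint
        (by rwa [uIcc_of_le hT.le]) 0 (by rwa [uIcc_of_le hT.le])
    have hc' := (Tendsto.mono_left hc (nhdsWithin_le_of_mem (by
      filter_upwards [hmem] with δ hδ
      rw [uIcc_of_le hT.le]
      exact ⟨hδ.1.le, hδ.2.le.trans ht.2⟩))).neg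
    simpa only [← intervalIntegral.integral_symm] using hc'
  have hle := le_of_tendsto_of_tendsto hKlim hIlim (by
    filter_upwards [hmem] with δ hδ
    exact K_le_integral_add_K hM h hT hδ.1.le hδ.2.le ht.2 (ho.feasible hδ.1))
  have hJ := J_le_K hM h hT le_rfl hT.le x₀ z₀
  have hadd := intervalIntegral.integral_add_adjacent_intervals (hsub h0' ht') (hsub ht' hT')
  have hcost := ho.cost_eq
  unfold totalCost at hcost ⊢
  linarith

/-! ### First variation and the co-state equations -/

lemma Feasible.perturb {t : ℝ} {x₀ z₀ : Fin M → ℝ} {x z u : ℝ → Fin M → ℝ}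
    (hf : P.Feasible t x₀ z₀ x z u) (i : Fin M) {g w w' : ℝ → ℝ}
    (hg : ∀ τ, HasDerivAt g (w τ - P.α i * g τ) τ) (hw : ∀ τ, HasDerivAt w (w' τ) τ)
    (hw' : Continuous w') (ε : ℝ) :
    P.Feasible t (x₀ + Pi.single i (ε * g t)) (z₀ - Pi.single i (ε * w t))
      (fun τ => x τ + Pi.single i (ε * g τ)) (fun τ => z τ - Pi.single i (ε * w τ))
      (fun τ => u τ - Pi.single i (ε * w' τ)) := by
  refine ⟨hf.continuousOn_input.sub (continuousOn_pi.2 fun k => ?_), fun τ hτ k => ⟨?_, ?_⟩,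
    by simp only [hf.init_x], by simp only [hf.init_z]⟩
  · by_cases hk : k = i
    · subst hk
      simp only [Pi.single_eq_same]
      exact (continuous_const.mul hw').continuousOn
    · simpa only [Pi.single_eq_of_ne hk] using continuousOn_const
  · by_cases hk : k = i
    · subst hk
      simp only [Pi.add_apply, Pi.sub_apply, Pi.single_eq_same]
      exact ((hf.state_eq τ hτ k).1.add ((hg τ).const_mul ε).hasDerivWithinAt).congr_deriv
        (by ring)
    · simpa only [Pi.add_apply, Pi.sub_apply, Pi.single_eq_of_ne hk, add_zero, sub_zero]
        using (hf.state_eq τ hτ k).1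
  · by_cases hk : k = i
    · subst hk
      simp only [Pi.sub_apply, Pi.single_eq_same]
      exact (hf.state_eq τ hτ k).2.sub ((hw τ).const_mul ε).hasDerivWithinAt
    · simpa only [Pi.sub_apply, Pi.single_eq_of_ne hk, sub_zero] using (hf.state_eq τ hτ k).2

lemma hasDerivAt_totalCost_perturb (h : P.RegularData) (hT : 0 < P.T) {t : ℝ} (h0 : 0 ≤ t)
    (htT : t ≤ P.T) {x₀ z₀ : Fin M → ℝ} {x z u : ℝ → Fin M → ℝ}
    (hf : P.Feasible t x₀ z₀ x z u) (i : Fin M) {g w w' : ℝ → ℝ}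
    (hg : ∀ τ, HasDerivAt g (w τ - P.α i * g τ) τ) (hw : ∀ τ, HasDerivAt w (w' τ) τ)
    (hw' : Continuous w') :
    HasDerivAt (fun ε : ℝ => P.totalCost t (fun τ => x τ + Pi.single i (ε * g τ))
      (fun τ => z τ - Pi.single i (ε * w τ)) (fun τ => u τ - Pi.single i (ε * w' τ)))
      (∫ τ in t..P.T, (deriv (P.c i) (x τ i) * g τ + deriv P.cg (P.ℓ τ - ∑ k, z τ k) * w τ
        - 2 * P.κ * ((∑ k, u τ k) - P.dℓ τ) * w' τ)) 0 := by
  have cg' : Continuous g := continuous_iff_continuousAt.2 fun τ => (hg τ).continuousAt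
  have cw : Continuous w := continuous_iff_continuousAt.2 fun τ => (hw τ).continuousAt
  have hs : Icc t P.T ⊆ Icc 0 P.T := Icc_subset_Icc_left h0
  have cx := continuousOn_pi.1 hf.state_eq.continuousOn_x i
  have cz := continuousOn_finsetSum Finset.univ
    fun k _ => continuousOn_pi.1 hf.state_eq.continuousOn_z k
  have cu := continuousOn_finsetSum Finset.univ
    fun k _ => continuousOn_pi.1 hf.continuousOn_input k
  have cℓ := h.contDiffOn_ℓ.continuousOn.mono hs
  have cdℓ := (continuousOn_dℓ h hT).mono hs
  let F' : ℝ → ℝ → ℝ := fun ε τ => deriv (P.c i) (x τ i + ε * g τ) * g τ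
    + deriv P.cg (P.ℓ τ - ((∑ k, z τ k) - ε * w τ)) * w τ
    - 2 * P.κ * (((∑ k, u τ k) - ε * w' τ) - P.dℓ τ) * w' τ
  have cF : ContinuousOn (fun q : ℝ × ℝ => F' q.1 q.2) (Icc (-1) 1 ×ˢ Icc t P.T) := by
    have m2 : MapsTo (Prod.snd : ℝ × ℝ → ℝ) (Icc (-1) 1 ×ˢ Icc t P.T) (Icc t P.T) :=
      fun q hq => hq.2
    have s2 : ∀ {f : ℝ → ℝ}, ContinuousOn f (Icc t P.T) →
        ContinuousOn (fun q : ℝ × ℝ => f q.2) (Icc (-1) 1 ×ˢ Icc t P.T) :=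
      fun hf => hf.comp continuousOn_snd m2
    have c1 : ContinuousOn (fun q : ℝ × ℝ => q.1) (Icc (-1) 1 ×ˢ Icc t P.T) := continuousOn_fst
    have e1 := s2 cg'.continuousOn
    have e2 := s2 cw.continuousOn
    have e3 := s2 hw'.continuousOn
    refine ((((continuous_deriv_c h i).comp_continuousOn ((s2 cx).add (c1.mul e1))).mul e1).add
      (((continuous_deriv_cg h).comp_continuousOn
        ((s2 cℓ).sub ((s2 cz).sub (c1.mul e2)))).mul e2)).sub
      ((continuousOn_const.mul (((s2 cu).sub (c1.mul e3)).sub (s2 cdℓ))).mul e3)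
  obtain ⟨B, hB⟩ := (isCompact_Icc.prod isCompact_Icc).exists_bound_of_continuousOn cF
  have hfe := fun ε => (hf.perturb i hg hw hw' ε).continuousOn_runningCost h hT h0
  have hcF0 : ContinuousOn (F' 0) (Icc t P.T) :=
    cF.comp (continuousOn_const.prodMk continuousOn_id)
      fun τ hτ => ⟨⟨by norm_num, by norm_num⟩, hτ⟩
  have hder : ∀ τ ε : ℝ, HasDerivAt (fun ε => P.runningCost (x τ + Pi.single i (ε * g τ))
      (z τ - Pi.single i (ε * w τ)) (u τ - Pi.single i (ε * w' τ)) τ) (F' ε τ) ε := by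
    intro τ ε
    have hlin : ∀ a : ℝ, HasDerivAt (fun ε : ℝ => ε * a) a ε := fun a => by
      simpa using (hasDerivAt_id ε).mul_const a
    have d1 : HasDerivAt (fun ε => ∑ k, P.c k (x τ k + (Pi.single i (ε * g τ) : Fin M → ℝ) k))
        (deriv (P.c i) (x τ i + ε * g τ) * g τ) ε := by
      have : ∀ k ∈ Finset.univ, HasDerivAt
          (fun ε => P.c k (x τ k + (Pi.single i (ε * g τ) : Fin M → ℝ) k))
          (if k = i then deriv (P.c i) (x τ i + ε * g τ) * g τ else 0) ε := by
        intro k _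
        by_cases hk : k = i
        · subst hk
          simp only [Pi.single_eq_same, if_true]
          exact (hasDerivAt_c h k _).comp ε ((hlin _).const_add _)
        · simp only [Pi.single_eq_of_ne hk, if_neg hk]
          exact hasDerivAt_const _ _
      simpa using HasDerivAt.fun_sum this
    have d2 := (hasDerivAt_cg h (P.ℓ τ - ((∑ k, z τ k) - ε * w τ))).comp ε
      (((hlin (w τ)).const_sub (∑ k, z τ k)).const_sub (P.ℓ τ))
    have d3 := ((((hlin (w' τ)).const_sub (∑ k, u τ k)).sub_const (P.dℓ τ)).pow 2).const_mul P.κ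
    refine (((d1.add d2).add d3).congr_deriv ?_).congr_of_eventuallyEq
      (Eventually.of_forall fun ε => ?_)
    · simp only [F']
      ring
    · simp [runningCost, Finset.sum_sub_distrib]
  have m1 : ∀ᶠ ε : ℝ in 𝓝 0, AEStronglyMeasurable
      (fun τ => P.runningCost (x τ + Pi.single i (ε * g τ)) (z τ - Pi.single i (ε * w τ))
        (u τ - Pi.single i (ε * w' τ)) τ) (volume.restrict (uIoc t P.T)) :=
    Eventually.of_forall fun ε => by
      rw [uIoc_of_le htT]
      exact ((hfe ε).mono Ioc_subset_Icc_self).aestronglyMeasurable measurableSet_Ioc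
  have m2 : AEStronglyMeasurable (F' 0) (volume.restrict (uIoc t P.T)) := by
    rw [uIoc_of_le htT]
    exact (hcF0.mono Ioc_subset_Icc_self).aestronglyMeasurable measurableSet_Ioc
  have hbound : ∀ τ, τ ∈ uIoc t P.T → ∀ ε ∈ Icc (-1 : ℝ) 1, ‖F' ε τ‖ ≤ B := by
    intro τ hτ ε hε
    rw [uIoc_of_le htT] at hτ
    exact hB (ε, τ) ⟨hε, Ioc_subset_Icc_self hτ⟩
  have key := (intervalIntegral.hasDerivAt_integral_of_dominated_loc_of_deriv_le
    (s := Icc (-1) 1) (bound := fun _ => B) (Icc_mem_nhds (by norm_num) (by norm_num)) m1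
    ((hfe 0).intervalIntegrable_of_Icc htT) m2 (ae_of_all _ hbound) intervalIntegrable_const
    (ae_of_all _ fun τ _ ε _ => hder τ ε)).2
  refine key.congr_deriv ?_
  simp only [F', zero_mul, add_zero, sub_zero]

/-- The envelope identity: as the value function lies below the cost of every perturbed
trajectory, with equality at `ε = 0`, both have the same derivative at `ε = 0`. -/
lemma envelope (hM : 0 < M) (h : P.RegularData) (hT : 0 < P.T) (hK : P.ValueC1)
    {x₀ z₀ : Fin M → ℝ} {x z u : ℝ → Fin M → ℝ} (ho : P.IsOptimal 0 x₀ z₀ x z u)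
    {t : ℝ} (ht : t ∈ Ioc 0 P.T) (i : Fin M) {g w w' : ℝ → ℝ}
    (hg : ∀ τ, HasDerivAt g (w τ - P.α i * g τ) τ) (hw : ∀ τ, HasDerivAt w (w' τ) τ)
    (hw' : Continuous w') {φ' : ℝ}
    (hφ : HasDerivAt (fun ε => P.K ((∑ k, x t k) + ε * g t) ((∑ k, z t k) - ε * w t) t) φ' 0) :
    φ' = ∫ τ in t..P.T, (deriv (P.c i) (x τ i) * g τ + deriv P.cg (P.ℓ τ - ∑ k, z τ k) * w τ
        - 2 * P.κ * ((∑ k, u τ k) - P.dℓ τ) * w' τ) := by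
  have hf := ho.feasible ht.1
  have hd := hasDerivAt_totalCost_perturb h hT ht.1.le ht.2 hf i hg hw hw'
  refine (sub_eq_zero.1 (IsLocalMin.hasDerivAt_eq_zero (Eventually.of_forall fun ε => ?_)
    (hd.sub hφ))).symm
  have hle : P.K ((∑ k, x t k) + ε * g t) ((∑ k, z t k) - ε * w t) t ≤
      P.totalCost t (fun τ => x τ + Pi.single i (ε * g τ))
      (fun τ => z τ - Pi.single i (ε * w τ)) (fun τ => u τ - Pi.single i (ε * w' τ)) := by
    refine le_trans (le_of_eq ?_) ((K_le_J h ht.2 _ _).trans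
      (J_le h ht.2 (hf.perturb i hg hw hw' ε)))
    simp [Finset.sum_add_distrib, Finset.sum_sub_distrib]
  have heq := ho.totalCost_eq_K hM h hT hK ht
  simp only [Pi.sub_apply, zero_mul, Pi.single_zero, add_zero, sub_zero]
  linarith

lemma hasDerivAt_K_fst (hK : P.ValueC1) {t : ℝ} (ht : t ∈ Icc 0 P.T) (r s : ℝ) :
    HasDerivAt (fun r => P.K r s t) (deriv (fun r => P.K r s t) r) r := by
  have hd : ContDiffOn ℝ 1 (fun r : ℝ => P.K r s t) univ :=
    ContDiffOn.comp (f := fun r : ℝ => (r, s, t)) hK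
      (by fun_prop) fun r _ => ⟨mem_univ _, mem_univ _, ht⟩
  exact ((contDiffOn_univ.1 hd).differentiable one_ne_zero r).hasDerivAt

lemma hasDerivAt_K_snd (hK : P.ValueC1) {t : ℝ} (ht : t ∈ Icc 0 P.T) (r s : ℝ) :
    HasDerivAt (fun s => P.K r s t) (deriv (fun s => P.K r s t) s) s := by
  have hd : ContDiffOn ℝ 1 (fun s : ℝ => P.K r s t) univ :=
    ContDiffOn.comp (f := fun s : ℝ => (r, s, t)) hK
      (by fun_prop) fun r _ => ⟨mem_univ _, mem_univ _, ht⟩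
  exact ((contDiffOn_univ.1 hd).differentiable one_ne_zero s).hasDerivAt

lemma hasDerivAt_exp_neg_mul (a τ : ℝ) :
    HasDerivAt (fun τ => Real.exp (-a * τ)) (-a * Real.exp (-a * τ)) τ := by
  have := ((hasDerivAt_id τ).const_mul (-a)).exp
  exact this.congr_deriv (by simp [mul_comm])

section Optimal

variable {x₀ z₀ : Fin M → ℝ} {x z u : ℝ → Fin M → ℝ}

/-- The first variation along the decaying mode `exp (-α i τ)` of the class `i`, which leaves `z`
and `u` unchanged. -/
lemma lam_mul_exp (hM : 0 < M) (h : P.RegularData) (hT : 0 < P.T) (hK : P.ValueC1)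
    (ho : P.IsOptimal 0 x₀ z₀ x z u) (i : Fin M) {t : ℝ} (ht : t ∈ Ioc 0 P.T) :
    P.lam x z t * Real.exp (-P.α i * t) =
      ∫ τ in t..P.T, deriv (P.c i) (x τ i) * Real.exp (-P.α i * τ) := by
  have hφ : HasDerivAt (fun ε => P.K ((∑ k, x t k) + ε * Real.exp (-P.α i * t))
      ((∑ k, z t k) - ε * 0) t) (P.lam x z t * Real.exp (-P.α i * t)) 0 := by
    simp only [mul_zero, sub_zero]
    have hlin : HasDerivAt (fun ε => (∑ k, x t k) + ε * Real.exp (-P.α i * t))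
        (Real.exp (-P.α i * t)) 0 := by
      simpa using ((hasDerivAt_id (0 : ℝ)).mul_const (Real.exp (-P.α i * t))).const_add
        (∑ k, x t k)
    refine HasDerivAt.comp (h₂ := fun r => P.K r (∑ k, z t k) t) 0 ?_ hlin
    rw [zero_mul, add_zero]
    exact hasDerivAt_K_fst hK ⟨ht.1.le, ht.2⟩ _ _
  have := envelope hM h hT hK ho ht i (g := fun τ => Real.exp (-P.α i * τ)) (w := fun _ => 0)
    (w' := fun _ => 0) (fun τ => (hasDerivAt_exp_neg_mul _ τ).congr_deriv (by ring))
    (fun τ => hasDerivAt_const _ _) continuous_const hφ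
  simpa only [mul_zero, add_zero, sub_zero] using this

lemma lam_terminal (hM : 0 < M) (h : P.RegularData) (hT : 0 < P.T) (hK : P.ValueC1)
    (ho : P.IsOptimal 0 x₀ z₀ x z u) : P.lam x z P.T = 0 := by
  have := lam_mul_exp hM h hT hK ho ⟨0, hM⟩ ⟨hT, le_rfl⟩
  rw [intervalIntegral.integral_same] at this
  exact (mul_eq_zero.1 this).resolve_right (Real.exp_ne_zero _)

lemma continuousOn_marginal (h : P.RegularData) (ho : P.IsOptimal 0 x₀ z₀ x z u) (i : Fin M) :
    ContinuousOn (fun τ => deriv (P.c i) (x τ i)) (Ioc 0 P.T) :=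
  (continuous_deriv_c h i).comp_continuousOn (continuousOn_pi.1 ho.state_eq.continuousOn_x i)

lemma hasDerivWithinAt_lam (hM : 0 < M) (h : P.RegularData) (hT : 0 < P.T) (hK : P.ValueC1)
    (ho : P.IsOptimal 0 x₀ z₀ x z u) (i : Fin M) {t : ℝ} (ht : t ∈ Ioc 0 P.T) :
    HasDerivWithinAt (P.lam x z) (-deriv (P.c i) (x t i) + P.α i * P.lam x z t) (Ioc 0 P.T) t := by
  have hexp : ∀ τ, Real.exp (-P.α i * τ) * Real.exp (P.α i * τ) = 1 := fun τ => by
    rw [← Real.exp_add]; simp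
  have hd := hasDerivWithinAt_of_eq_tail_integral
    (f := fun τ => deriv (P.c i) (x τ i) * Real.exp (-P.α i * τ))
    ((continuousOn_marginal h ho i).mul (by fun_prop))
    (fun t ht => lam_mul_exp hM h hT hK ho i ht) ht
  have he : HasDerivAt (fun τ => Real.exp (P.α i * τ)) (P.α i * Real.exp (P.α i * t)) t := by
    simpa using hasDerivAt_exp_neg_mul (-P.α i) t
  have heq : ∀ τ, P.lam x z τ = P.lam x z τ * Real.exp (-P.α i * τ) * Real.exp (P.α i * τ) :=
    fun τ => by rw [mul_assoc, hexp, mul_one]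
  refine ((hd.mul he.hasDerivWithinAt).congr_deriv ?_).congr (fun τ _ => heq τ) (heq t)
  linear_combination (-deriv (P.c i) (x t i) + P.α i * P.lam x z t) * hexp t

lemma continuousOn_lam (hM : 0 < M) (h : P.RegularData) (hT : 0 < P.T) (hK : P.ValueC1)
    (ho : P.IsOptimal 0 x₀ z₀ x z u) : ContinuousOn (P.lam x z) (Ioc 0 P.T) :=
  fun _ ht => (hasDerivWithinAt_lam hM h hT hK ho ⟨0, hM⟩ ht).continuousWithinAt

lemma continuousOn_generation_add_lam (hM : 0 < M) (h : P.RegularData) (hT : 0 < P.T)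
    (hK : P.ValueC1) (ho : P.IsOptimal 0 x₀ z₀ x z u) :
    ContinuousOn (fun τ => deriv P.cg (P.ℓ τ - ∑ k, z τ k) + P.lam x z τ) (Ioc 0 P.T) :=
  ((continuous_deriv_cg h).comp_continuousOn
    ((h.contDiffOn_ℓ.continuousOn.mono Ioc_subset_Icc_self).sub
    (continuousOn_finsetSum Finset.univ
      fun k _ => continuousOn_pi.1 ho.state_eq.continuousOn_z k))).add
    (continuousOn_lam hM h hT hK ho)

lemma continuousOn_ramp (h : P.RegularData) (hT : 0 < P.T) (ho : P.IsOptimal 0 x₀ z₀ x z u) :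
    ContinuousOn (fun τ => 2 * P.κ * ((∑ k, u τ k) - P.dℓ τ)) (Ioc 0 P.T) :=
  continuousOn_const.mul ((continuousOn_finsetSum Finset.univ
    fun k _ => continuousOn_pi.1 (continuousOn_Ioc_input ho) k).sub
    ((continuousOn_dℓ h hT).mono Ioc_subset_Icc_self))

/-- The first variation in a direction that changes `z_σ` by `-ε w` and leaves the initial state
of charge unchanged. The marginal costs of the states of charge are eliminated by means of the
equation for `λ` and an integration by parts. -/
lemma bet_mul (hM : 0 < M) (h : P.RegularData) (hT : 0 < P.T) (hK : P.ValueC1)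
    (ho : P.IsOptimal 0 x₀ z₀ x z u) {w w' : ℝ → ℝ} (hw : ∀ τ, HasDerivAt w (w' τ) τ)
    (hw' : Continuous w') {t : ℝ} (ht : t ∈ Ioc 0 P.T) :
    -(P.bet x z t * w t) =
      ∫ τ in t..P.T, ((deriv P.cg (P.ℓ τ - ∑ k, z τ k) + P.lam x z τ) * w τ
        - 2 * P.κ * ((∑ k, u τ k) - P.dℓ τ) * w' τ) := by
  let i : Fin M := ⟨0, hM⟩
  have cw : Continuous w := continuous_iff_continuousAt.2 fun τ => (hw τ).continuousAt
  have hexp : ∀ τ, Real.exp (-P.α i * τ) * Real.exp (P.α i * τ) = 1 := fun τ => by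
    rw [← Real.exp_add]; simp
  -- the solution of `g' = w - α i * g`, `g t = 0`
  let g : ℝ → ℝ := fun τ => Real.exp (-P.α i * τ) * ∫ s in t..τ, Real.exp (P.α i * s) * w s
  have hg : ∀ τ, HasDerivAt g (w τ - P.α i * g τ) τ := fun τ => by
    have cI : Continuous fun s => Real.exp (P.α i * s) * w s := by fun_prop
    refine ((hasDerivAt_exp_neg_mul (P.α i) τ).mul
      (cI.integral_hasStrictDerivAt t τ).hasDerivAt).congr_deriv ?_
    simp only [g]
    linear_combination w τ * hexp τ
  have hgt : g t = 0 := by simp [g]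
  have hgc : Continuous g := continuous_iff_continuousAt.2 fun τ => (hg τ).continuousAt
  have hφ : HasDerivAt (fun ε => P.K ((∑ k, x t k) + ε * g t)
      ((∑ k, z t k) - ε * w t) t) (P.bet x z t * -w t) 0 := by
    simp only [hgt, mul_zero, add_zero]
    have hlin : HasDerivAt (fun ε => (∑ k, z t k) - ε * w t) (-w t) 0 := by
      simpa using ((hasDerivAt_id (0 : ℝ)).mul_const (w t)).const_sub (∑ k, z t k)
    refine HasDerivAt.comp (h₂ := fun s => P.K (∑ k, x t k) s t) 0 ?_ hlin
    rw [zero_mul, sub_zero]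
    exact hasDerivAt_K_snd hK ⟨ht.1.le, ht.2⟩ _ _
  have henv := envelope hM h hT hK ho ht i hg hw hw' hφ
  have hs : Icc t P.T ⊆ Ioc 0 P.T := fun s hs => ⟨ht.1.trans_le hs.1, hs.2⟩
  have cl := (continuousOn_lam hM h hT hK ho).mono hs
  have cm := (continuousOn_marginal h ho i).mono hs
  have cq := (continuousOn_generation_add_lam hM h hT hK ho).mono hs
  have cp := (continuousOn_ramp h hT ho).mono hs
  have cint₂ : ContinuousOn (fun τ => P.lam x z τ * w τ - deriv (P.c i) (x τ i) * g τ)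
      (Icc t P.T) := (cl.mul cw.continuousOn).sub (cm.mul hgc.continuousOn)
  have hparts : ∫ τ in t..P.T, (P.lam x z τ * w τ - deriv (P.c i) (x τ i) * g τ) = 0 := by
    have hd : ∀ τ ∈ Ioo t P.T, HasDerivAt (fun τ => P.lam x z τ * g τ)
        (P.lam x z τ * w τ - deriv (P.c i) (x τ i) * g τ) τ := fun τ hτ => by
      have hτ' : τ ∈ Ioo 0 P.T := ⟨ht.1.trans hτ.1, hτ.2⟩
      refine (((hasDerivWithinAt_lam hM h hT hK ho i (Ioo_subset_Ioc_self hτ')).hasDerivAt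
        (Ioc_mem_nhds hτ'.1 hτ'.2)).mul (hg τ)).congr_deriv ?_
      ring
    rw [intervalIntegral.integral_eq_sub_of_hasDerivAt_of_le ht.2 (cl.mul hgc.continuousOn) hd
      (cint₂.intervalIntegrable_of_Icc ht.2), Pi.mul_apply, Pi.mul_apply,
      lam_terminal hM h hT hK ho, hgt]
    ring
  have cint : ContinuousOn (fun τ => (deriv P.cg (P.ℓ τ - ∑ k, z τ k) + P.lam x z τ) * w τ
      - 2 * P.κ * ((∑ k, u τ k) - P.dℓ τ) * w' τ) (Icc t P.T) :=
    (cq.mul cw.continuousOn).sub (cp.mul hw'.continuousOn)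
  rw [← sub_zero (∫ τ in t..P.T, _), ← hparts, ← intervalIntegral.integral_sub
    (cint.intervalIntegrable_of_Icc ht.2)
    (cint₂.intervalIntegrable_of_Icc ht.2),
    ← mul_neg, henv]
  exact intervalIntegral.integral_congr fun τ _ => by ring

lemma neg_bet_eq_integral (hM : 0 < M) (h : P.RegularData) (hT : 0 < P.T) (hK : P.ValueC1)
    (ho : P.IsOptimal 0 x₀ z₀ x z u) {t : ℝ} (ht : t ∈ Ioc 0 P.T) :
    -P.bet x z t = ∫ τ in t..P.T, (deriv P.cg (P.ℓ τ - ∑ k, z τ k) + P.lam x z τ) := by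
  simpa only [mul_one, mul_zero, sub_zero] using
    bet_mul hM h hT hK ho (w := fun _ => 1) (fun τ => hasDerivAt_const τ 1) continuous_const ht

lemma bet_terminal (hM : 0 < M) (h : P.RegularData) (hT : 0 < P.T) (hK : P.ValueC1)
    (ho : P.IsOptimal 0 x₀ z₀ x z u) : P.bet x z P.T = 0 := by
  have := neg_bet_eq_integral hM h hT hK ho ⟨hT, le_rfl⟩
  rwa [intervalIntegral.integral_same, neg_eq_zero] at this

lemma hasDerivWithinAt_bet (hM : 0 < M) (h : P.RegularData) (hT : 0 < P.T) (hK : P.ValueC1)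
    (ho : P.IsOptimal 0 x₀ z₀ x z u) {t : ℝ} (ht : t ∈ Ioc 0 P.T) :
    HasDerivWithinAt (P.bet x z) (deriv P.cg (P.ℓ t - ∑ k, z t k) + P.lam x z t)
      (Ioc 0 P.T) t := by
  have := (hasDerivWithinAt_of_eq_tail_integral (continuousOn_generation_add_lam hM h hT hK ho)
    (fun t ht => neg_bet_eq_integral hM h hT hK ho ht) ht).neg
  simpa only [neg_neg, Pi.neg_def] using this

/-- The variation with `w = τ` represents `t β(t)` as an integral over `[t, T]`. Its derivative in
`t`, compared with the one that the equation for `β` gives, is the optimality of the input. -/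
lemma ramp_eq_neg_bet (hM : 0 < M) (h : P.RegularData) (hT : 0 < P.T) (hK : P.ValueC1)
    (ho : P.IsOptimal 0 x₀ z₀ x z u) {t : ℝ} (ht : t ∈ Ioc 0 P.T) :
    2 * P.κ * ((∑ k, u t k) - P.dℓ t) = -P.bet x z t := by
  have cq := continuousOn_generation_add_lam hM h hT hK ho
  have cp := continuousOn_ramp h hT ho
  have cint := (cq.mul continuousOn_id).sub cp
  have hG : ∀ t ∈ Ioc 0 P.T, -(t * P.bet x z t) = ∫ τ in t..P.T,
      ((deriv P.cg (P.ℓ τ - ∑ k, z τ k) + P.lam x z τ) * τ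
        - 2 * P.κ * ((∑ k, u τ k) - P.dℓ τ)) := by
    intro t ht
    simpa only [mul_one, mul_comm (P.bet x z t)] using
      bet_mul hM h hT hK ho (w := fun τ => τ) hasDerivAt_id continuous_const ht
  have d1 := hasDerivWithinAt_of_eq_tail_integral cint hG ht
  have d2 := ((hasDerivWithinAt_id t (Ioc 0 P.T)).mul (hasDerivWithinAt_bet hM h hT hK ho ht)).neg
  have := (uniqueDiffOn_Ioc 0 P.T t ht).eq_deriv _ d1 d2
  simp only [id, Pi.sub_apply, Pi.mul_apply] at this
  linarith

lemma input_sum_eq (hM : 0 < M) (h : P.RegularData) (hT : 0 < P.T) (hK : P.ValueC1)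
    (ho : P.IsOptimal 0 x₀ z₀ x z u) {t : ℝ} (ht : t ∈ Ioc 0 P.T) :
    ∑ k, u t k = P.dℓ t - 1 / (2 * P.κ) * P.bet x z t := by
  have hκ := h.κ_pos.ne'
  have := ramp_eq_neg_bet hM h hT hK ho ht
  field_simp
  linarith

end Optimal

end Model
/-! ### Uniqueness for the boundary value problem -/

lemma exists_abs_le_of_tendsto {f : ℝ → ℝ} {T a : ℝ} (hf : ContinuousOn f (Ioc 0 T))
    (ha : Tendsto f (𝓝[>] 0) (𝓝 a)) : ∃ C, ∀ t ∈ Ioc 0 T, |f t| ≤ C := by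
  have h1 : ∀ᶠ t in 𝓝[>] (0 : ℝ), |f t| < |a| + 1 :=
    ha.abs.eventually (gt_mem_nhds (lt_add_one _))
  obtain ⟨δ, hδ, h2⟩ := mem_nhdsGT_iff_exists_Ioo_subset.1 h1
  obtain ⟨C, hC⟩ := (isCompact_Icc (a := δ / 2) (b := T)).exists_bound_of_continuousOn
    (hf.mono fun t ht => ⟨(half_pos hδ).trans_le ht.1, ht.2⟩)
  refine ⟨max (|a| + 1) C, fun t ht => ?_⟩
  rcases lt_or_ge t δ with h | h
  · exact le_max_of_le_left (le_of_lt (h2 ⟨ht.1, h⟩))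
  · exact le_max_of_le_right (hC t ⟨(half_le_self (le_of_lt hδ)).trans h, ht.2⟩)

lemma exists_abs_le_of_deriv_bounded {f f' : ℝ → ℝ} {T C : ℝ} (hT : 0 < T)
    (hf : ∀ t ∈ Ioc 0 T, HasDerivWithinAt f (f' t) (Ioc 0 T) t)
    (hC : ∀ t ∈ Ioc 0 T, |f' t| ≤ C) : ∃ B, ∀ t ∈ Ioc 0 T, |f t| ≤ B := by
  have hTm : T ∈ Ioc 0 T := ⟨hT, le_rfl⟩
  have hC0 : 0 ≤ C := (abs_nonneg _).trans (hC T hTm)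
  refine ⟨|f T| + C * T, fun t ht => ?_⟩
  have h1 := (convex_Ioc 0 T).norm_image_sub_le_of_norm_hasDerivWithin_le hf hC hTm ht
  rw [Real.norm_eq_abs, Real.norm_eq_abs] at h1
  have h2 : |t - T| ≤ T := by
    rw [abs_le]
    constructor <;> linarith [ht.1, ht.2]
  have h3 := mul_le_mul_of_nonneg_left h2 hC0
  have h4 := abs_sub_abs_le_abs_sub (f t) (f T)
  linarith

lemma sub_mul_sub_nonneg_of_monotone {f : ℝ → ℝ} (hf : Monotone f) (a b : ℝ) :
    0 ≤ (f a - f b) * (a - b) := by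
  rcases le_total a b with h | h
  · exact mul_nonneg_of_nonpos_of_nonpos (sub_nonpos.2 (hf h)) (sub_nonpos.2 h)
  · exact mul_nonneg (sub_nonneg.2 (hf h)) (sub_nonneg.2 h)

namespace Model

variable {M : ℕ} {P : Model M}

lemma strictMono_deriv_c (h : P.RegularData) (i : Fin M) : StrictMono (deriv (P.c i)) := by
  obtain ⟨μ, hμ, h1, -⟩ := h.strongly_convex
  exact strictMono_of_deriv_pos fun y => hμ.trans_le (h1 i y)

lemma strictMono_deriv_cg (h : P.RegularData) : StrictMono (deriv P.cg) := by
  obtain ⟨μ, hμ, -, h2⟩ := h.strongly_convex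
  exact strictMono_of_deriv_pos fun y => hμ.trans_le (h2 y)

/-- The initial condition on `(x, z)` keeps the co-states bounded near time `0`, since they solve
linear equations with bounded source terms. -/
lemma SolvesSystem.exists_abs_le (hM : 0 < M) (h : P.RegularData) (hT : 0 < P.T)
    {xp zp : Fin M → ℝ} {x z u : ℝ → Fin M → ℝ} {l b : ℝ → ℝ}
    (hs : P.SolvesSystem xp zp x z u l b) :
    ∃ B, ∀ t ∈ Ioc 0 P.T, |l t| ≤ B ∧ |b t| ≤ B := by
  let i : Fin M := ⟨0, hM⟩
  have cx := continuousOn_pi.1 hs.state_eq.continuousOn_x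
  have cz := continuousOn_pi.1 hs.state_eq.continuousOn_z
  have hexp : ∀ τ, Real.exp (P.α i * τ) * Real.exp (-P.α i * τ) = 1 := fun τ => by
    rw [← Real.exp_add]; simp
  -- the integrating factor turns the equation for `l` into a quadrature
  have hd : ∀ t ∈ Ioc 0 P.T, HasDerivWithinAt (fun τ => Real.exp (-P.α i * τ) * l τ)
      (-(Real.exp (-P.α i * t) * deriv (P.c i) (x t i))) (Ioc 0 P.T) t := fun t ht => by
    refine ((hasDerivAt_exp_neg_mul (P.α i) t).hasDerivWithinAt.mul
      (hs.costate_l t ht i)).congr_deriv ?_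
    ring
  obtain ⟨C, hC⟩ := exists_abs_le_of_tendsto (T := P.T)
    (f := fun t => -(Real.exp (-P.α i * t) * deriv (P.c i) (x t i)))
    (a := -(Real.exp (-P.α i * 0) * deriv (P.c i) (xp i)))
    ((ContinuousOn.mul (by fun_prop) ((continuous_deriv_c h i).comp_continuousOn (cx i))).neg)
    (((((by fun_prop : Continuous fun t => Real.exp (-P.α i * t)).tendsto 0).mono_left
      nhdsWithin_le_nhds).mul (((continuous_deriv_c h i).tendsto _).comp
        (tendsto_pi_nhds.1 hs.init_x i))).neg)
  obtain ⟨B₁, hB₁⟩ := exists_abs_le_of_deriv_bounded hT hd hC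
  obtain ⟨E, hE⟩ := (isCompact_Icc (a := 0) (b := P.T)).exists_bound_of_continuousOn
    (f := fun s => Real.exp (P.α i * s)) (by fun_prop)
  have hl : ∀ t ∈ Ioc 0 P.T, |l t| ≤ E * B₁ := fun t ht => by
    have e : l t = Real.exp (P.α i * t) * (Real.exp (-P.α i * t) * l t) := by
      rw [← mul_assoc, hexp, one_mul]
    have hEt := hE t (Ioc_subset_Icc_self ht)
    rw [e, abs_mul]
    exact mul_le_mul hEt (hB₁ t ht) (abs_nonneg _) ((norm_nonneg _).trans hEt)
  have h0 : (0 : ℝ) ∈ Icc 0 P.T := ⟨le_rfl, hT.le⟩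
  have hℓ : Tendsto P.ℓ (𝓝[>] 0) (𝓝 (P.ℓ 0)) := by
    refine Tendsto.mono_left (h.contDiffOn_ℓ.continuousOn 0 h0) (nhdsWithin_le_of_mem ?_)
    exact mem_of_superset (Ioo_mem_nhdsGT hT) Ioo_subset_Icc_self
  obtain ⟨C', hC'⟩ := exists_abs_le_of_tendsto (T := P.T)
    (f := fun t => deriv P.cg (P.ℓ t - ∑ k, z t k)) (a := deriv P.cg (P.ℓ 0 - ∑ k, zp k))
    ((continuous_deriv_cg h).comp_continuousOn
      ((h.contDiffOn_ℓ.continuousOn.mono Ioc_subset_Icc_self).sub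
        (continuousOn_finsetSum _ fun k _ => cz k)))
    (((continuous_deriv_cg h).tendsto _).comp
      (hℓ.sub (tendsto_finsetSum _ fun k _ => tendsto_pi_nhds.1 hs.init_z k)))
  obtain ⟨B₂, hB₂⟩ := exists_abs_le_of_deriv_bounded hT hs.costate_b (C := C' + E * B₁)
    fun t ht => (abs_add_le _ _).trans (add_le_add (hC' t ht) (hl t ht))
  exact ⟨max (E * B₁) B₂, fun t ht =>
    ⟨le_max_of_le_left (hl t ht), le_max_of_le_right (hB₂ t ht)⟩⟩

/-- Uniqueness, by monotonicity: the pairing of the differences of the co-states and of the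
aggregate states of two solutions is nonincreasing and vanishes at both ends of `(0, T]`, whence
all the monotone terms in its derivative vanish. -/
lemma SolvesSystem.unique (hM : 0 < M) (h : P.RegularData) (hT : 0 < P.T)
    {xp zp : Fin M → ℝ} {x z u x' z' u' : ℝ → Fin M → ℝ} {l b l' b' : ℝ → ℝ}
    (hs : P.SolvesSystem xp zp x z u l b) (hs' : P.SolvesSystem xp zp x' z' u' l' b') :
    EqOn x' x (Ioc 0 P.T) ∧ EqOn z' z (Ioc 0 P.T) ∧ EqOn u' u (Ioc 0 P.T) ∧
      EqOn l' l (Ioc 0 P.T) ∧ EqOn b' b (Ioc 0 P.T) := by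
  have hκ := h.κ_pos
  have hu : UniqueDiffOn ℝ (Ioc 0 P.T) := uniqueDiffOn_Ioc 0 P.T
  let F : ℝ → ℝ := fun t => (∑ i, (l' t - l t) * (x' t i - x t i)) +
    (b' t - b t) * ((∑ i, z' t i) - ∑ i, z t i)
  let A : ℝ → ℝ := fun t => ∑ i, (deriv (P.c i) (x' t i) - deriv (P.c i) (x t i)) *
    (x' t i - x t i)
  let G : ℝ → ℝ := fun t => (deriv P.cg (P.ℓ t - ∑ i, z' t i) -
    deriv P.cg (P.ℓ t - ∑ i, z t i)) * ((P.ℓ t - ∑ i, z' t i) - (P.ℓ t - ∑ i, z t i))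
  have hF : ∀ t ∈ Ioc 0 P.T, HasDerivWithinAt F
      (-(A t + G t + 1 / (2 * P.κ) * (b' t - b t) ^ 2)) (Ioc 0 P.T) t := by
    intro t ht
    have d1 : HasDerivWithinAt (fun t => ∑ i, (l' t - l t) * (x' t i - x t i))
        (∑ i, (-((deriv (P.c i) (x' t i) - deriv (P.c i) (x t i)) * (x' t i - x t i))
          - (l' t - l t) * (z' t i - z t i))) (Ioc 0 P.T) t :=
      HasDerivWithinAt.fun_sum fun i _ =>
        (((hs'.costate_l t ht i).sub (hs.costate_l t ht i)).mul
          ((hs'.state_eq t ht i).1.sub (hs.state_eq t ht i).1)).congr_deriv (by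
            simp only [Pi.sub_apply]; ring)
    have d2 := ((hs'.costate_b t ht).sub (hs.costate_b t ht)).mul
      ((hs'.state_eq.sum_z ht).sub (hs.state_eq.sum_z ht))
    refine (d1.add d2).congr_deriv ?_
    rw [hs'.input_sum t ht, hs.input_sum t ht, Finset.sum_sub_distrib, Finset.sum_neg_distrib,
      ← Finset.mul_sum, Finset.sum_sub_distrib]
    simp only [A, G, Pi.sub_apply]
    ring
  have hA0 : ∀ t, 0 ≤ A t := fun t => Finset.sum_nonneg fun i _ =>
    sub_mul_sub_nonneg_of_monotone (strictMono_deriv_c h i).monotone _ _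
  have hG0 : ∀ t, 0 ≤ G t := fun t =>
    sub_mul_sub_nonneg_of_monotone (strictMono_deriv_cg h).monotone _ _
  have hb0 : ∀ t, 0 ≤ 1 / (2 * P.κ) * (b' t - b t) ^ 2 := fun t => by positivity
  have hanti : AntitoneOn F (Ioc 0 P.T) := by
    refine antitoneOn_of_hasDerivWithinAt_nonpos (convex_Ioc 0 P.T)
      (fun t ht => (hF t ht).continuousWithinAt)
      (fun t ht => (hF t (interior_subset ht)).mono interior_subset) fun t _ => ?_
    linarith [hA0 t, hG0 t, hb0 t]
  have hFT : F P.T = 0 := by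
    simp [F, hs.terminal_l, hs'.terminal_l, hs.terminal_b, hs'.terminal_b]
  have hF0 : Tendsto F (𝓝[>] 0) (𝓝 0) := by
    obtain ⟨B, hB⟩ := hs.exists_abs_le hM h hT
    obtain ⟨B', hB'⟩ := hs'.exists_abs_le hM h hT
    have hmem : ∀ᶠ t in 𝓝[>] (0 : ℝ), t ∈ Ioc 0 P.T :=
      mem_of_superset (Ioo_mem_nhdsGT hT) Ioo_subset_Ioc_self
    have hbdd : ∀ {f f' g g' : ℝ → ℝ} {a : ℝ}, (∀ t ∈ Ioc 0 P.T, |f t| ≤ B) →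
        (∀ t ∈ Ioc 0 P.T, |f' t| ≤ B') → Tendsto g (𝓝[>] 0) (𝓝 a) →
        Tendsto g' (𝓝[>] 0) (𝓝 a) →
        Tendsto (fun t => (f' t - f t) * (g' t - g t)) (𝓝[>] 0) (𝓝 0) := by
      intro f f' g g' a hf hf' hg hg'
      have h0 : Tendsto (fun t => g' t - g t) (𝓝[>] 0) (𝓝 0) := by simpa using hg'.sub hg
      have h1 : Tendsto (fun t => (B' + B) * |g' t - g t|) (𝓝[>] 0) (𝓝 0) := by
        simpa using h0.abs.const_mul (B' + B)
      refine squeeze_zero_norm' ?_ h1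
      filter_upwards [hmem] with t ht
      rw [norm_mul]
      exact mul_le_mul_of_nonneg_right ((abs_sub _ _).trans (add_le_add (hf' t ht) (hf t ht)))
        (abs_nonneg _)
    have hx := tendsto_pi_nhds.1 hs.init_x
    have hx' := tendsto_pi_nhds.1 hs'.init_x
    have hz := tendsto_pi_nhds.1 hs.init_z
    have hz' := tendsto_pi_nhds.1 hs'.init_z
    have t1 : Tendsto (fun t => ∑ i, (l' t - l t) * (x' t i - x t i)) (𝓝[>] 0)
        (𝓝 (∑ _i : Fin M, 0)) := tendsto_finsetSum _ fun i _ =>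
      hbdd (fun t ht => (hB t ht).1) (fun t ht => (hB' t ht).1) (hx i) (hx' i)
    have t2 := hbdd (fun t ht => (hB t ht).2) (fun t ht => (hB' t ht).2)
      (tendsto_finsetSum Finset.univ fun i _ => hz i)
      (tendsto_finsetSum Finset.univ fun i _ => hz' i)
    simpa using t1.add t2
  have hFz : ∀ t ∈ Ioc 0 P.T, F t = 0 := by
    intro t ht
    refine le_antisymm (ge_of_tendsto hF0 ?_) (hFT ▸ hanti ht ⟨hT, le_rfl⟩ ht.2)
    filter_upwards [Ioo_mem_nhdsGT ht.1] with s hs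
    exact hanti ⟨hs.1, hs.2.le.trans ht.2⟩ ht hs.2.le
  have hzero : ∀ t ∈ Ioc 0 P.T, A t + G t + 1 / (2 * P.κ) * (b' t - b t) ^ 2 = 0 := by
    intro t ht
    have := (hu t ht).eq_deriv _ (hF t ht)
      ((hasDerivWithinAt_const t (Ioc 0 P.T) (0 : ℝ)).congr hFz (hFz t ht))
    linarith
  have hx : EqOn x' x (Ioc 0 P.T) := by
    intro t ht
    ext i
    have hA : A t = 0 := by linarith [hzero t ht, hA0 t, hG0 t, hb0 t]
    have := (Finset.sum_eq_zero_iff_of_nonneg fun i _ =>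
      sub_mul_sub_nonneg_of_monotone (strictMono_deriv_c h i).monotone _ _).1 hA i
      (Finset.mem_univ i)
    rcases mul_eq_zero.1 this with h0 | h0
    · exact (strictMono_deriv_c h i).injective (sub_eq_zero.1 h0)
    · exact sub_eq_zero.1 h0
  have hb : EqOn b' b (Ioc 0 P.T) := by
    intro t ht
    have hb : 1 / (2 * P.κ) * (b' t - b t) ^ 2 = 0 := by
      linarith [hzero t ht, hA0 t, hG0 t, hb0 t]
    have := (mul_eq_zero.1 hb).resolve_left (by positivity)
    exact sub_eq_zero.1 (pow_eq_zero_iff two_ne_zero |>.1 this)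
  have hz : EqOn z' z (Ioc 0 P.T) := by
    intro t ht
    ext i
    have := (hu t ht).eq_deriv _ (hs'.state_eq t ht i).1
      ((hs.state_eq t ht i).1.congr (fun τ hτ => congrFun (hx hτ) i) (congrFun (hx ht) i))
    rw [hx ht] at this
    linarith
  refine ⟨hx, hz, fun t ht => ?_, fun t ht => ?_, hb⟩
  · ext i
    exact (hu t ht).eq_deriv _ (hs'.state_eq t ht i).2
      ((hs.state_eq t ht i).2.congr (fun τ hτ => congrFun (hz hτ) i) (congrFun (hz ht) i))
  · have := (hu t ht).eq_deriv _ (hs'.costate_b t ht) ((hs.costate_b t ht).congr hb (hb ht))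
    rw [hz ht] at this
    linarith

/-! ### The marginal cost diffeomorphism and the collapse subspace -/

lemma surjective_deriv_c (h : P.RegularData) (i : Fin M) :
    Function.Surjective (deriv (P.c i)) := by
  obtain ⟨μ, hμ, h1, -⟩ := h.strongly_convex
  have hd : ContDiff ℝ 1 (deriv (P.c i)) :=
    (contDiff_succ_iff_deriv.1 (show ContDiff ℝ (1 + 1) (P.c i) from h.contDiff_c i)).2.2
  -- `c_i' - μ • id` is monotone
  have hmono : Monotone fun y => deriv (P.c i) y - μ * y := by
    have hder : ∀ y, HasDerivAt (fun y => deriv (P.c i) y - μ * y)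
        (deriv (deriv (P.c i)) y - μ) y := fun y =>
      ((hd.differentiable one_ne_zero y).hasDerivAt.sub
        ((hasDerivAt_id y).const_mul μ)).congr_deriv (by rw [mul_one])
    refine monotone_of_deriv_nonneg (fun y => (hder y).differentiableAt) fun y => ?_
    rw [(hder y).deriv]
    exact sub_nonneg.2 (h1 i y)
  refine (continuous_deriv_c h i).surjective ?_ ?_
  · refine tendsto_atTop_mono' _ ?_
      (tendsto_atTop_add_const_left _ (deriv (P.c i) 0) (tendsto_id.const_mul_atTop hμ))
    filter_upwards [eventually_ge_atTop 0] with y hy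
    have := hmono hy
    simp only [mul_zero, sub_zero, id] at this ⊢
    linarith
  · refine tendsto_atBot_mono' _ ?_
      (tendsto_atBot_add_const_left _ (deriv (P.c i) 0) (tendsto_id.const_mul_atBot hμ))
    filter_upwards [eventually_le_atBot 0] with y hy
    have := hmono hy
    simp only [mul_zero, sub_zero, id] at this ⊢
    linarith

lemma exists_homeomorph_deriv_c (h : P.RegularData) (i : Fin M) :
    ∃ e : ℝ ≃ₜ ℝ, (∀ y, e y = deriv (P.c i) y) ∧ ContDiff ℝ 1 e ∧ ContDiff ℝ 1 e.symm := by
  obtain ⟨μ, hμ, h1, -⟩ := h.strongly_convex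
  have hd : ContDiff ℝ 1 (deriv (P.c i)) :=
    (contDiff_succ_iff_deriv.1 (show ContDiff ℝ (1 + 1) (P.c i) from h.contDiff_c i)).2.2
  let e : ℝ ≃ₜ ℝ := (StrictMono.orderIsoOfSurjective _ (strictMono_deriv_c h i)
    (surjective_deriv_c h i)).toHomeomorph
  exact ⟨e, fun _ => rfl, hd, e.contDiff_symm_deriv
    (f' := deriv (deriv (P.c i))) (fun y => (hμ.trans_le (h1 i y)).ne')
    (fun y => (hd.differentiable one_ne_zero y).hasDerivAt) hd⟩

lemma exists_homeomorph_marginalCost (h : P.RegularData) :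
    ∃ e : (Fin M → ℝ) ≃ₜ (Fin M → ℝ), (∀ y, e y = P.marginalCost y) ∧
      ContDiff ℝ 1 e ∧ ContDiff ℝ 1 e.symm := by
  choose e he hc hc' using fun i => exists_homeomorph_deriv_c h i
  exact ⟨Homeomorph.piCongrRight e, fun y => funext fun i => he i (y i),
    contDiff_pi.2 fun i => (hc i).comp (contDiff_apply ℝ ℝ i),
    contDiff_pi.2 fun i => (hc' i).comp (contDiff_apply ℝ ℝ i)⟩

variable (P) in
lemma finrank_collapseSubspace_le : Module.finrank ℝ P.collapseSubspace ≤ 2 := by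
  classical
  have := finrank_span_finset_le_card (R := ℝ) ({P.α, fun _ => 1} : Finset (Fin M → ℝ))
  rw [Finset.coe_pair] at this
  exact this.trans Finset.card_le_two

lemma finrank_collapseSubspace_eq_two {i j : Fin M} (hij : P.α i ≠ P.α j) :
    Module.finrank ℝ P.collapseSubspace = 2 := by
  have hli : LinearIndependent ℝ ![P.α, fun _ => 1] := by
    refine LinearIndependent.pair_iff.2 fun s t hst => ?_
    have hi := congrFun hst i
    have hj := congrFun hst j
    simp only [Pi.add_apply, Pi.smul_apply, smul_eq_mul, mul_one, Pi.zero_apply] at hi hj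
    have hs : s = 0 := by
      have : s * (P.α i - P.α j) = 0 := by linarith
      exact (mul_eq_zero.1 this).resolve_right (sub_ne_zero.2 hij)
    subst hs
    exact ⟨rfl, by simpa using hi⟩
  have := finrank_span_eq_card hli
  rwa [Matrix.range_cons, Matrix.range_cons, Matrix.range_empty, union_empty,
    singleton_union, Fintype.card_fin] at this

end Model
end DemandDispatch

/-! ### State space collapse -/

theorem theorem1 {M : ℕ} (hM : 0 < M) (P : Model M) (hT : 0 < P.T)
    (h1 : P.RegularData) (h2 : P.UniqueOptimal) (h3 : P.ValueC1)
    (x₀ z₀ : Fin M → ℝ) (x z u : ℝ → Fin M → ℝ) (hopt : P.IsOptimal 0 x₀ z₀ x z u)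
    (h4 : P.CostateC2 x z) :
    -- the optimal solution is the unique solution of the system of `3M + 2` equations
    (∃ xp zp : Fin M → ℝ, ∑ i, xp i = ∑ i, x₀ i ∧ ∑ i, zp i = ∑ i, z₀ i ∧
      P.SolvesSystem xp zp x z u (P.lam x z) (P.bet x z) ∧
      ∀ x' z' u' l' b', P.SolvesSystem xp zp x' z' u' l' b' →
        EqOn x' x (Ioc 0 P.T) ∧ EqOn z' z (Ioc 0 P.T) ∧ EqOn u' u (Ioc 0 P.T) ∧
        EqOn l' (P.lam x z) (Ioc 0 P.T) ∧ EqOn b' (P.bet x z) (Ioc 0 P.T)) ∧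
    -- the marginal costs, as functions on `(0, T]`, lie in the span of `λ*` and `dλ*/dt`
    (∀ i, (fun t : Ioc 0 P.T => deriv (P.c i) (x t i)) ∈
      Submodule.span ℝ {(fun t : Ioc 0 P.T => P.lam x z t),
        (fun t : Ioc 0 P.T => derivWithin (P.lam x z) (Ioc 0 P.T) t)}) ∧
    -- state space collapse: the marginal cost map is a `C¹` diffeomorphism `e` of `ℝ^M`, and
    -- `x*` evolves on the preimage under `e` of a linear subspace of dimension at most two
    (∃ e : (Fin M → ℝ) ≃ₜ (Fin M → ℝ), (∀ y, e y = P.marginalCost y) ∧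
      ContDiff ℝ 1 e ∧ ContDiff ℝ 1 e.symm ∧
      ∀ t ∈ Ioc 0 P.T, x t ∈ e ⁻¹' (P.collapseSubspace : Set (Fin M → ℝ)) ∧
        x t = e.symm (fun i => P.α i * P.lam x z t
          - derivWithin (P.lam x z) (Ioc 0 P.T) t)) ∧
    Module.finrank ℝ P.collapseSubspace ≤ 2 ∧
    ((∃ i j, P.α i ≠ P.α j) → Module.finrank ℝ P.collapseSubspace = 2) := by
  have hmarg : ∀ i, ∀ t ∈ Ioc 0 P.T, deriv (P.c i) (x t i) =
      P.α i * P.lam x z t - derivWithin (P.lam x z) (Ioc 0 P.T) t := by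
    intro i t ht
    rw [(Model.hasDerivWithinAt_lam hM h1 hT h3 hopt i ht).derivWithin
      (uniqueDiffOn_Ioc 0 P.T t ht)]
    ring
  refine ⟨?_, fun i => ?_, ?_, P.finrank_collapseSubspace_le,
    fun ⟨i, j, hij⟩ => Model.finrank_collapseSubspace_eq_two hij⟩
  · obtain ⟨xp, zp, hxp, hzp, hxs, hzs⟩ := hopt.right_limits
    have hsol : P.SolvesSystem xp zp x z u (P.lam x z) (P.bet x z) :=
      { state_eq := hopt.state_eq
        costate_l := fun t ht i => Model.hasDerivWithinAt_lam hM h1 hT h3 hopt i ht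
        costate_b := fun t ht => Model.hasDerivWithinAt_bet hM h1 hT h3 hopt ht
        input_sum := fun t ht => Model.input_sum_eq hM h1 hT h3 hopt ht
        init_x := hxp
        init_z := hzp
        terminal_l := Model.lam_terminal hM h1 hT h3 hopt
        terminal_b := Model.bet_terminal hM h1 hT h3 hopt }
    exact ⟨xp, zp, hxs, hzs, hsol, fun x' z' u' l' b' hs' => hsol.unique hM h1 hT hs'⟩
  · refine Submodule.mem_span_pair.2 ⟨P.α i, -1, funext fun t => ?_⟩
    rw [hmarg i t t.2]
    simp only [Pi.add_apply, Pi.smul_apply, smul_eq_mul]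
    ring
  · obtain ⟨e, he, hc, hc'⟩ := Model.exists_homeomorph_marginalCost h1
    have hex : ∀ t ∈ Ioc 0 P.T, e (x t) = fun i => P.α i * P.lam x z t
        - derivWithin (P.lam x z) (Ioc 0 P.T) t := fun t ht => by
      rw [he]
      exact funext fun i => hmarg i t ht
    refine ⟨e, he, hc, hc', fun t ht => ⟨?_, ?_⟩⟩
    · rw [mem_preimage, hex t ht]
      refine Submodule.mem_span_pair.2
        ⟨P.lam x z t, -derivWithin (P.lam x z) (Ioc 0 P.T) t, funext fun i => ?_⟩
      simp only [Pi.add_apply, Pi.smul_apply, smul_eq_mul]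
      ring
    · rw [← hex t ht, e.symm_apply_apply]
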